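/- Let $N\ge 1$ and let $C\subset\mathbb{R}^N_+$ be a compact convex set containing the unit simplex $\Sigma=\{x\in\mathbb{R}^N: x_i\ge 0,\ x_1+\cdots+x_N\le 1\}$. For $k\in\mathbb{Z}_{\ge 0}$ let $\mathrm{Poly}(kC)$ be the space of polynomials $\sum_{\beta\in kC\cap\mathbb{Z}^N}c_\beta z^\beta$ with complex coefficients, and put $$M_k=\#(kC\cap\mathbb{Z}^N),\qquad L_k=\sum_{\alpha\in kC\cap\mathbb{Z}^N}|\alpha|,\qquad |\alpha|=\alpha_1+\cdots+\alpha_N .$$ For $\alpha,\beta\in\mathbb{Z}_{\ge0}^N$ write $\alpha\prec\beta$ if $|\alpha|<|\beta|$, or if $|\alpha|=|\beta|$ and there is an index $i$ with $\alpha_i<\beta_i$ and $\alpha_m=\beta_m$ for all $m<i$. Let $r(\alpha)=\inf\{r\ge 0:\alpha\in rC\}$, and write $\alpha\prec_C\beta$ if $r(\alpha)<r(\beta)$, or if $r(\alpha)=r(\beta)$ and $\alpha\prec\beta$. For $\alpha\in kC\cap\mathbb{Z}^N$ let $\mathcal{M}_k^C(\alpha)$ be the set of polynomials in $\mathrm{Poly}(kC)$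 of the form $z^\alpha+\sum_{\beta\in kC\cap\mathbb{Z}^N,\ \beta\prec_C\alpha}a_\beta z^\beta$. Assume that $C$ satisfies $(\dagger)$ for all $k,l\in\mathbb{Z}_{\ge0}$, $\alpha\in kC\cap\mathbb{Z}^N$ and $p\in\mathcal{M}_k^C(\alpha)$ there is $j_0$ such that, for every $\delta\in lC\cap\mathbb{Z}^N$ and every $j\ge j_0$, $z^\delta p^j\in\mathcal{M}^C_{jk+l}(j\alpha+\delta)$. Let $\alpha(1),\alpha(2),\dots$ be the enumeration of $\mathbb{Z}_{\ge0}^N$ in increasing order for $\prec_C$, and for points $\zeta_1,\dots,\zeta_s\in\mathbb{C}^N$ let $VDM(\zeta_1,\dots,\zeta_s)=\det\bigl[\zeta_l^{\alpha(j)}\bigr]_{j,l=1}^s$. For a non-empty compact set $K\subset\mathbb{C}^N$ put $V_k(K)=\sup\{|VDM(\zeta_1,\dots,\zeta_{M_k})|:\zeta_1,\dots,\zeta_{M_k}\in K\}$; up to order, $\alpha(1),\dots,\alpha(M_k)$ are exactly the points of $kC\cap\mathbb{Z}^N$, and $V_k(K)$ does not depend on how these are enumerated. The $C$-transfinite diameter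 of $K$ is $$\delta_C(K)=\limsup_{k\to\infty}V_k(K)^{1/L_k}.$$ A sequence $\{\zeta_j\}_{j\ge1}\subset K$ is a sequence of (unweighted) $C$-Leja points for $K$ if $\zeta_1\in K$ is arbitrary and, for each $s\ge1$, $$|VDM(\zeta_1,\dots,\zeta_s,\zeta_{s+1})|=\sup_{\eta\in K}|VDM(\zeta_1,\dots,\zeta_s,\eta)| .$$ **Theorem.** If $\{\zeta_j\}_{j\ge1}$ is any sequence of unweighted $C$-Leja points for $K$, then $$\lim_{k\to\infty}|VDM(\zeta_1,\dots,\zeta_{M_k})|^{1/L_k}=\delta_C(K).$$ -/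

import Mathlib

open Filter Topology
open scoped Pointwise

noncomputable section

namespace CDegree

variable {N : ℕ}

/-- The unit simplex `Σ = {x : x₁, …, x_N ≥ 0, x₁ + ⋯ + x_N ≤ 1}` in `ℝ^N`. -/
def unitSimplex (N : ℕ) : Set (Fin N → ℝ) :=
  {x | (∀ i, 0 ≤ x i) ∧ ∑ i, x i ≤ 1}

/-- A multi-index in `ℤ_+^N`, viewed as a point of `ℝ^N`. -/
def toReal (α : Fin N →₀ ℕ) : Fin N → ℝ := fun i => (α i : ℝ)

theorem toReal_injective : Function.Injective (toReal : (Fin N →₀ ℕ) → Fin N → ℝ) := by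
  intro α β h
  ext i
  have := congrFun h i
  simpa [toReal] using this

theorem finite_of_isBounded {s : Set (Fin N → ℝ)} (hs : Bornology.IsBounded s) :
    {α : Fin N →₀ ℕ | toReal α ∈ s}.Finite := by
  obtain ⟨R, hR⟩ := hs.exists_norm_le
  refine (Set.finite_Iic
    (Finsupp.equivFunOnFinite.symm (fun _ : Fin N => ⌊R⌋₊) : Fin N →₀ ℕ)).subset ?_
  intro α hα i
  have h1 : ‖toReal α i‖ ≤ R := (norm_le_pi_norm _ i).trans (hR _ hα)
  have h2 : (α i : ℝ) ≤ R := by simpa [toReal] using h1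
  simpa using Nat.le_floor h2

theorem latticePoints_finite (C : ConvexBody (Fin N → ℝ)) (k : ℕ) :
    {α : Fin N →₀ ℕ | toReal α ∈ (k : ℝ) • (C : Set (Fin N → ℝ))}.Finite :=
  finite_of_isBounded (C.isCompact.isBounded.smul₀ (k : ℝ))

/-- The finite set of multi-indices in `kC`.  (When `C` lies in the nonnegative orthant this is
all of `kC ∩ ℤ^N`.) -/
def latticePoints (C : ConvexBody (Fin N → ℝ)) (k : ℕ) : Finset (Fin N →₀ ℕ) :=
  (latticePoints_finite C k).toFinset

/-- `M_k`, the number of lattice points of `kC`. -/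
def M (C : ConvexBody (Fin N → ℝ)) (k : ℕ) : ℕ := (latticePoints C k).card

/-- `L_k`, the sum of the ordinary degrees `|α|` over the lattice points `α` of `kC`. -/
def L (C : ConvexBody (Fin N → ℝ)) (k : ℕ) : ℕ := ∑ α ∈ latticePoints C k, ∑ i, α i

/-- `Poly(kC)`: the polynomials all of whose exponents lie in `kC`. -/
def Poly (C : ConvexBody (Fin N → ℝ)) (k : ℕ) : Set (MvPolynomial (Fin N) ℂ) :=
  {p | ∀ β ∈ p.support, β ∈ latticePoints C k}

/-- The `C`-degree `min {n : p ∈ Poly(nC)}`. -/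
def cDeg (C : ConvexBody (Fin N → ℝ)) (p : MvPolynomial (Fin N) ℂ) : ℕ :=
  sInf {n : ℕ | p ∈ Poly C n}

/-- The ordering `≺`: first by total degree, then by the first differing coordinate. -/
def grevlexLT (α β : Fin N →₀ ℕ) : Prop :=
  ∑ i, α i < ∑ i, β i ∨
    (∑ i, α i = ∑ i, β i ∧ ∃ k, α k < β k ∧ ∀ j < k, α j = β j)

/-- `r(α) = inf {r ≥ 0 : α ∈ rC}`. -/
def radius (C : ConvexBody (Fin N → ℝ)) (α : Fin N →₀ ℕ) : ℝ :=
  sInf {r : ℝ | 0 ≤ r ∧ toReal α ∈ r • (C : Set (Fin N → ℝ))}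

/-- The ordering `≺_C`: first by `r`, then by `≺`. -/
def cLT (C : ConvexBody (Fin N → ℝ)) (α β : Fin N →₀ ℕ) : Prop :=
  radius C α < radius C β ∨ (radius C α = radius C β ∧ grevlexLT α β)

/-- The class of `p ∈ Poly(kC)` of the form `z^α + ∑_{β ≺_C α} a_β z^β`. -/
def monicClass (C : ConvexBody (Fin N → ℝ)) (k : ℕ) (α : Fin N →₀ ℕ) :
    Set (MvPolynomial (Fin N) ℂ) :=
  {p | p ∈ Poly C k ∧ p.coeff α = 1 ∧ ∀ β ∈ p.support, β ≠ α → cLT C β α}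

/-- Condition `(†)`: for all `k, l`, all `α ∈ kC` and `p = z^α + (≺_C-lower terms)` in `Poly(kC)`
there is `j₀` such that for every `δ ∈ lC` and `j ≥ j₀` the polynomial `z^δ p^j` lies in
`Poly((jk+l)C)` and equals `z^{jα+δ} + (≺_C-lower terms)`. -/
def Dagger (C : ConvexBody (Fin N → ℝ)) : Prop :=
  ∀ k l : ℕ, ∀ α ∈ latticePoints C k, ∀ p ∈ monicClass C k α,
    ∃ j₀ : ℕ, ∀ δ ∈ latticePoints C l, ∀ j : ℕ, j₀ ≤ j →
      MvPolynomial.monomial δ (1 : ℂ) * p ^ j ∈ monicClass C (j * k + l) (j • α + δ)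

/-- The weighted Vandermonde determinant `det [w(ζ_l)^k ζ_l^{a_j}]_{j,l}`. -/
def vdm {ι : Type*} [Fintype ι] [DecidableEq ι] (w : (Fin N → ℂ) → ℝ) (k : ℕ)
    (a : ι → Fin N →₀ ℕ) (ζ : ι → Fin N → ℂ) : ℂ :=
  Matrix.det (Matrix.of fun j l : ι => (w (ζ l) : ℂ) ^ k * ∏ i, ζ l i ^ a j i)

/-- `V_k^w(K, M_k)`: the supremum of `|VDM_k^w|` over families of `M_k` points of `K`.  Rows and
columns are indexed by the lattice points of `kC` themselves; the modulus of the determinant does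
not depend on how these are enumerated. -/
def maxVdm (C : ConvexBody (Fin N → ℝ)) (w : (Fin N → ℂ) → ℝ) (K : Set (Fin N → ℂ)) (k : ℕ) : ℝ :=
  sSup {v : ℝ | ∃ ζ : latticePoints C k → Fin N → ℂ, (∀ l, ζ l ∈ K) ∧
    v = ‖vdm w k (fun j : latticePoints C k => (j : Fin N →₀ ℕ)) ζ‖}

/-- The `k`-th order `C`-diameter `V_k^w(K, M_k)^{1/L_k}`. -/
def diameter (C : ConvexBody (Fin N → ℝ)) (w : (Fin N → ℂ) → ℝ) (K : Set (Fin N → ℂ))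
    (k : ℕ) : ℝ :=
  maxVdm C w K k ^ (1 / (L C k : ℝ))

/-- The `C`-transfinite diameter `limsup_k V_k^w(K, M_k)^{1/L_k}`. -/
def transfiniteDiameter (C : ConvexBody (Fin N → ℝ)) (w : (Fin N → ℂ) → ℝ)
    (K : Set (Fin N → ℂ)) : ℝ :=
  limsup (fun k : ℕ => diameter C w K k) atTop

/-- `a 0, a 1, a 2, …` lists all multi-indices, each once, in increasing order for `≺_C`. -/
structure IsEnumeration (C : ConvexBody (Fin N → ℝ)) (a : ℕ → Fin N →₀ ℕ) : Prop where
  bijective : Function.Bijective a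
  increasing : ∀ i j : ℕ, i < j → cLT C (a i) (a j)

/-- An infinite linear order with finite initial segments is order isomorphic to `ℕ`. -/
theorem nonempty_orderIso_nat {ι : Type*} [LinearOrder ι] [Infinite ι]
    (h : ∀ b : ι, (Set.Iic b).Finite) : Nonempty (ι ≃o ℕ) := by
  classical
  have : NoMaxOrder ι := ⟨fun b => by
    by_contra hb
    push Not at hb
    exact Set.infinite_univ ((h b).subset fun x _ => hb x)⟩
  let : LocallyFiniteOrder ι := LocallyFiniteOrder.ofFiniteIcc
    (fun x y => (h y).subset fun z hz => hz.2)
  obtain ⟨m, -, hm⟩ := Set.exists_min_image (Set.Iic (Classical.arbitrary ι)) id (h _)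
    ⟨_, le_refl _⟩
  let : OrderBot ι :=
    { bot := m
      bot_le := fun x => by
        rcases le_total x (Classical.arbitrary ι) with hx | hx
        · exact hm x hx
        · exact (hm _ (le_refl (Classical.arbitrary ι))).trans hx }
  let : SuccOrder ι := LinearLocallyFiniteOrder.succOrder ι
  let : PredOrder ι := LinearLocallyFiniteOrder.predOrder ι
  exact ⟨orderIsoNatOfLinearSuccPredArch⟩

theorem cLT_iff (C : ConvexBody (Fin N → ℝ)) (α β : Fin N →₀ ℕ) :
    cLT C α β ↔ toLex (radius C α, toLex (∑ i, α i, toLex (fun i => α i))) <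
      toLex (radius C β, toLex (∑ i, β i, toLex (fun i => β i))) := by
  rw [Prod.Lex.toLex_lt_toLex, Prod.Lex.toLex_lt_toLex]
  refine or_congr Iff.rfl (and_congr Iff.rfl (or_congr Iff.rfl (and_congr Iff.rfl ?_)))
  constructor
  · rintro ⟨k, h1, h2⟩
    exact ⟨k, h2, h1⟩
  · rintro ⟨k, h2, h1⟩
    exact ⟨k, h1, h2⟩

theorem finite_radius_le {C : ConvexBody (Fin N → ℝ)}
    (hC : unitSimplex N ⊆ (C : Set (Fin N → ℝ))) (ρ : ℝ) :
    {α : Fin N →₀ ℕ | radius C α ≤ ρ}.Finite := by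
  obtain ⟨R, hRpos, hR⟩ := C.isCompact.isBounded.exists_pos_norm_le
  refine (finite_of_isBounded (Metric.isBounded_closedBall
    (x := (0 : Fin N → ℝ)) (r := (ρ + 1) * R))).subset ?_
  intro α hα
  have hne : {r : ℝ | 0 ≤ r ∧ toReal α ∈ r • (C : Set (Fin N → ℝ))}.Nonempty := by
    have hpos : (0 : ℝ) < ∑ i, (α i : ℝ) + 1 := by positivity
    refine ⟨∑ i, (α i : ℝ) + 1, hpos.le,
      (∑ i, (α i : ℝ) + 1)⁻¹ • toReal α, hC ⟨fun i => ?_, ?_⟩, ?_⟩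
    · simp only [Pi.smul_apply, smul_eq_mul, toReal]
      positivity
    · simp only [Pi.smul_apply, smul_eq_mul, toReal, ← Finset.mul_sum]
      rw [inv_mul_le_iff₀ hpos]
      linarith
    · exact smul_inv_smul₀ hpos.ne' _
  obtain ⟨r, ⟨hr0, x, hx, hxα⟩, hrlt⟩ := exists_lt_of_csInf_lt hne
    (show sInf _ < ρ + 1 from lt_of_le_of_lt hα (lt_add_one _))
  simp only [Set.mem_ofPred_eq, mem_closedBall_zero_iff]
  rw [← hxα]
  simp only [norm_smul, Real.norm_of_nonneg hr0]
  exact (mul_le_mul_of_nonneg_left (hR x hx) hr0).trans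
    (mul_le_mul_of_nonneg_right hrlt.le hRpos.le)

/-- For a convex body containing the unit simplex such an enumeration exists. -/
theorem exists_isEnumeration (hN : 1 ≤ N) (C : ConvexBody (Fin N → ℝ))
    (hC : unitSimplex N ⊆ (C : Set (Fin N → ℝ))) : ∃ a, IsEnumeration C a := by
  let f : (Fin N →₀ ℕ) → ℝ ×ₗ (ℕ ×ₗ Lex (Fin N → ℕ)) := fun α =>
    toLex (radius C α, toLex (∑ i, α i, toLex (fun i => α i)))
  have hf : Function.Injective f := by
    intro α β h
    have h1 := congrArg (fun x => ofLex (ofLex (ofLex x).2).2) h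
    ext i
    exact congrFun h1 i
  have : Nonempty (Fin N) := ⟨⟨0, hN⟩⟩
  have : Infinite (Set.range f) := Infinite.of_injective _ (Set.rangeFactorization_injective.2 hf)
  obtain ⟨e⟩ := nonempty_orderIso_nat (ι := Set.range f) (by
    rintro ⟨_, β, rfl⟩
    refine ((finite_radius_le hC (radius C β)).image (Set.rangeFactorization f)).subset ?_
    rintro ⟨_, α, rfl⟩ hα
    refine ⟨α, ?_, rfl⟩
    have h2 : f α ≤ f β := hα
    rcases (Prod.Lex.toLex_le_toLex.1 h2) with h | h
    · exact h.le
    · exact h.1.le)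
  let g := Equiv.ofInjective f hf
  refine ⟨fun n => g.symm (e.symm n), (g.symm.bijective.comp e.symm.bijective), ?_⟩
  intro i j hij
  rw [cLT_iff]
  have h3 : ∀ x : Set.range f, f (g.symm x) = x := fun x => Equiv.apply_ofInjective_symm hf x
  change f (g.symm (e.symm i)) < f (g.symm (e.symm j))
  rw [h3, h3]
  exact e.symm.strictMono hij

/-- `VDM(ζ_1, …, ζ_s)`: the Vandermonde determinant on the first `s ≥ 1` monomials in the
enumeration `a`, the exponent of the weight being the `C`-degree of the last of them, `a (s - 1)`. -/
def seqVdm (C : ConvexBody (Fin N → ℝ)) (w : (Fin N → ℂ) → ℝ) (a : ℕ → Fin N →₀ ℕ) {s : ℕ}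
    (ζ : Fin s → Fin N → ℂ) : ℂ :=
  vdm w (cDeg C (MvPolynomial.monomial (a (s - 1)) 1)) (fun j : Fin s => a j) ζ

/-- `ζ 0, ζ 1, …` is a sequence of `C`-Leja points for `K` and the weight `w`. -/
structure IsLeja (C : ConvexBody (Fin N → ℝ)) (w : (Fin N → ℂ) → ℝ) (a : ℕ → Fin N →₀ ℕ)
    (K : Set (Fin N → ℂ)) (ζ : ℕ → Fin N → ℂ) : Prop where
  mem : ∀ j, ζ j ∈ K
  weight_ne_zero : w (ζ 0) ≠ 0
  greedy : ∀ s : ℕ, 1 ≤ s → ∀ η ∈ K,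
    ‖seqVdm C w a (Fin.snoc (fun i : Fin s => ζ i) η : Fin (s + 1) → Fin N → ℂ)‖ ≤
      ‖seqVdm C w a (fun i : Fin (s + 1) => ζ i)‖

end CDegree

end

/-!
Write `V_k` for the maximal Vandermonde determinant `maxVdm` of the monomials in `Poly(kC)`, and
`D_k` for the determinant of the first `M_k` Leja points. The proof has two halves, which use two
different orders on the monomials.

**Leja points are almost optimal.** As a function of its last point, a Vandermonde determinant is,
up to the determinant of the earlier points, a monic polynomial for the enumeration `a`. Hence `D_k`
is a product of bounds on `K` for monic polynomials (`exists_prod_eq_norm_monomialDet`). Unitriangular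
row operations followed by Leibniz' formula bound every determinant by `M_k!` times such a product
(`norm_monomialDet_le`). As the first `M_k` terms of `a` are the lattice points of `kC`, this gives
`D_k ≤ V_k ≤ M_k! D_k` (`IsLeja.bounds`). Since `M_k` is of order `k ^ N` and `L_k` of order
`k ^ (N + 1)`, the `L_k`-th root of `M_k!` tends to `1`. So it suffices that `V_k ^ (1 / L_k)`
converges, and not merely along a subsequence.

**The maximal determinants converge.** Neither `V_k` nor the set `kC` depends on an order, so here
`≺_C` can be replaced by the lexicographic order, which is compatible with multiplication. The
Chebyshev constants `T_k(α)` for this order satisfy `T_{k+l}(α + β) ≤ T_k(α) T_l(β)`, and again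
`∏ T_k(α) ≤ V_k ≤ M_k! ∏ T_k(α)` (`maxVdm_bounds`). After normalization `log T` is a subadditive
function `G ≤ 0` on the pairs `(k, α)` with `α ∈ kC`. For these a Fekete lemma holds
(`exists_tendsto_sum_div_pow`): if `G ≥ -A k`, then `k ^ (-(N + 1)) ∑_{α ∈ kC} G k α` converges.
It follows from writing each `β ∈ jkC` as `∑_{i < j} ⌊(β + i) / j⌋` coordinatewise; as `β` varies,
every summand takes each value well inside `kC` exactly `j ^ N` times, and boundary points are
negligible because `M_k / k ^ N` tends to the volume of `C`.

The lower bound on `G` is obtained by cutting off at `-A k`, which preserves subadditivity. If for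
some `A` the cutoff is never active, this gives the limit. Otherwise there are arbitrarily negative
values of `G k α / k`, subadditivity spreads them to a positive proportion of all lattice points
(`sum_le_of_apply_le`), and the limit is `0`; this covers sets `K` on which some polynomial
vanishes.
-/

open Filter Topology
open scoped Pointwise

noncomputable section

namespace CDegree

variable {N : ℕ}

/-! ### Lattice points of dilates of `C` -/

theorem mem_latticePoints {C : ConvexBody (Fin N → ℝ)} {k : ℕ} {α : Fin N →₀ ℕ} :
    α ∈ latticePoints C k ↔ ∃ x ∈ C, (k : ℝ) • x = toReal α := by
  simp [latticePoints, Set.mem_smul_set]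

theorem toReal_add (α β : Fin N →₀ ℕ) : toReal (α + β) = toReal α + toReal β := by
  ext i; simp [toReal]

theorem sum_add (α β : Fin N →₀ ℕ) : ∑ i, (α + β) i = ∑ i, α i + ∑ i, β i := by
  simp [Finset.sum_add_distrib]

theorem add_mem_latticePoints {C : ConvexBody (Fin N → ℝ)} {k l : ℕ} {α β : Fin N →₀ ℕ}
    (hα : α ∈ latticePoints C k) (hβ : β ∈ latticePoints C l) :
    α + β ∈ latticePoints C (k + l) := by
  rw [mem_latticePoints] at *
  obtain ⟨x, hx, hxα⟩ := hα
  obtain ⟨y, hy, hyβ⟩ := hβ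
  have h : toReal (α + β) ∈ ((k : ℝ) + l) • (C : Set (Fin N → ℝ)) := by
    rw [C.convex.add_smul (by positivity) (by positivity), toReal_add, ← hxα, ← hyβ]
    exact Set.add_mem_add (Set.smul_mem_smul_set hx) (Set.smul_mem_smul_set hy)
  obtain ⟨z, hz, h⟩ := h
  exact ⟨z, hz, by push_cast; exact h⟩

theorem mem_latticePoints_of_sum_le {C : ConvexBody (Fin N → ℝ)}
    (hC : unitSimplex N ⊆ (C : Set (Fin N → ℝ))) {k : ℕ} {α : Fin N →₀ ℕ}
    (h : ∑ i, α i ≤ k) : α ∈ latticePoints C k := by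
  rw [mem_latticePoints]
  rcases Nat.eq_zero_or_pos k with rfl | hk
  · refine ⟨0, hC ⟨by simp, by simp⟩, ?_⟩
    ext i
    have : α i = 0 := by
      have := Finset.single_le_sum (f := fun i => α i) (fun i _ => Nat.zero_le _)
        (Finset.mem_univ i)
      omega
    simp [toReal, this]
  · have hk' : (0 : ℝ) < k := by exact_mod_cast hk
    refine ⟨(k : ℝ)⁻¹ • toReal α, hC ⟨fun i => ?_, ?_⟩, smul_inv_smul₀ hk'.ne' _⟩
    · simp only [Pi.smul_apply, smul_eq_mul, toReal]; positivity
    · simp only [Pi.smul_apply, smul_eq_mul, toReal, ← Finset.mul_sum]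
      rw [inv_mul_le_iff₀ hk', mul_one]
      exact_mod_cast h

theorem latticePoints_mono {C : ConvexBody (Fin N → ℝ)}
    (hC : unitSimplex N ⊆ (C : Set (Fin N → ℝ))) {k l : ℕ} (hkl : k ≤ l) :
    latticePoints C k ⊆ latticePoints C l := by
  intro α hα
  have h0 : (0 : Fin N →₀ ℕ) ∈ latticePoints C (l - k) :=
    mem_latticePoints_of_sum_le hC (by simp)
  simpa [Nat.add_sub_cancel' hkl] using add_mem_latticePoints hα h0

theorem M_pos {C : ConvexBody (Fin N → ℝ)}
    (hC : unitSimplex N ⊆ (C : Set (Fin N → ℝ))) (k : ℕ) : 0 < M C k :=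
  Finset.card_pos.2 ⟨0, mem_latticePoints_of_sum_le hC (by simp)⟩

/-- Total degree grows at most linearly in `k` on `kC`. -/
theorem exists_degree_bound (C : ConvexBody (Fin N → ℝ)) :
    ∃ A : ℝ, 0 ≤ A ∧ ∀ k : ℕ, ∀ α ∈ latticePoints C k, ((∑ i, α i : ℕ) : ℝ) ≤ A * k := by
  obtain ⟨R, hRpos, hR⟩ := C.isCompact.isBounded.exists_pos_norm_le
  refine ⟨N * R, by positivity, fun k α hα => ?_⟩
  obtain ⟨x, hx, hxα⟩ := mem_latticePoints.1 hα
  push_cast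
  calc ∑ i, (α i : ℝ) ≤ ∑ _i : Fin N, (k * R : ℝ) := by
        refine Finset.sum_le_sum fun i _ => ?_
        have h1 : (α i : ℝ) = k * x i := by
          have := congrFun hxα i
          simpa [toReal] using this.symm
        rw [h1]
        have h2 : x i ≤ R := (le_abs_self _).trans ((norm_le_pi_norm x i).trans (hR x hx))
        gcongr
    _ = N * R * k := by simp; ring

theorem volume_pos (C : ConvexBody (Fin N → ℝ))
    (hC : unitSimplex N ⊆ (C : Set (Fin N → ℝ))) :
    0 < MeasureTheory.volume.real (C : Set (Fin N → ℝ)) := by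
  refine ENNReal.toReal_pos ?_ C.isCompact.measure_lt_top.ne
  have hsub : Set.pi Set.univ (fun _ : Fin N => Set.Ioo (0 : ℝ) (1 / (N + 1))) ⊆
      (C : Set (Fin N → ℝ)) := by
    intro x hx
    refine hC ⟨fun i => (hx i trivial).1.le, ?_⟩
    calc ∑ i, x i ≤ ∑ _i : Fin N, (1 / (N + 1) : ℝ) :=
          Finset.sum_le_sum fun i _ => (hx i trivial).2.le
      _ ≤ 1 := by
          simp only [Finset.sum_const, Finset.card_univ, Fintype.card_fin, nsmul_eq_mul]
          rw [mul_one_div, div_le_one (by positivity)]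
          linarith
  have hopen : IsOpen (Set.pi Set.univ (fun _ : Fin N => Set.Ioo (0 : ℝ) (1 / (N + 1)))) :=
    isOpen_set_pi Set.finite_univ fun _ _ => isOpen_Ioo
  have hne : (Set.pi Set.univ (fun _ : Fin N => Set.Ioo (0 : ℝ) (1 / (N + 1)))).Nonempty :=
    Set.univ_pi_nonempty_iff.2 fun _ => Set.nonempty_Ioo.2 (by positivity)
  exact ((hopen.measure_pos MeasureTheory.volume hne).trans_le
    (MeasureTheory.measure_mono hsub)).ne'

theorem tendsto_M_div_pow (C : ConvexBody (Fin N → ℝ)) (hC₀ : ∀ x ∈ C, ∀ i, 0 ≤ x i) :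
    Tendsto (fun k : ℕ => (M C k : ℝ) / (k : ℝ) ^ N) atTop
      (𝓝 (MeasureTheory.volume.real (C : Set (Fin N → ℝ)))) := by
  have h := tendsto_card_div_pow_atTop_volume (C : Set (Fin N → ℝ)) C.isCompact.isBounded
    C.isCompact.isClosed.measurableSet (C.convex.addHaar_frontier _)
  rw [Fintype.card_fin] at h
  refine h.congr' ?_
  filter_upwards [eventually_gt_atTop 0] with k hk
  have hk' : (k : ℝ) ≠ 0 := by exact_mod_cast hk.ne'
  congr 2
  have himg : (C : Set (Fin N → ℝ)) ∩ (k : ℝ)⁻¹ •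
      (Submodule.span ℤ (Set.range (Pi.basisFun ℝ (Fin N))) : Set (Fin N → ℝ)) =
      (fun α => (k : ℝ)⁻¹ • toReal α) '' (latticePoints C k : Set (Fin N →₀ ℕ)) := by
    ext x
    simp only [Set.mem_inter_iff, Set.mem_inv_smul_set_iff₀ hk', SetLike.mem_coe,
      Module.Basis.mem_span_iff_repr_mem, Pi.basisFun_repr, Set.mem_image, mem_latticePoints]
    constructor
    · rintro ⟨hx, hz⟩
      choose z hz using hz
      refine ⟨Finsupp.equivFunOnFinite.symm fun i => (z i).toNat, ?_⟩
      have hval : toReal (Finsupp.equivFunOnFinite.symm fun i => (z i).toNat) = (k : ℝ) • x := by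
        ext i
        have h1 : (z i : ℝ) = k * x i := by simpa using hz i
        have h2 : 0 ≤ z i := by
          have : (0 : ℝ) ≤ z i := h1 ▸ mul_nonneg (by positivity) (hC₀ x hx i)
          exact_mod_cast this
        have h3 : (((z i).toNat : ℤ) : ℝ) = z i := by rw [Int.toNat_of_nonneg h2]
        change (((z i).toNat : ℕ) : ℝ) = k * x i
        rw [← h1, ← h3, Int.cast_natCast]
      exact ⟨⟨x, hx, hval.symm⟩, by rw [hval, inv_smul_smul₀ hk']⟩
    · rintro ⟨α, ⟨y, hy, hyα⟩, rfl⟩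
      refine ⟨by rw [← hyα, inv_smul_smul₀ hk']; exact hy, fun i => ⟨α i, ?_⟩⟩
      rw [smul_inv_smul₀ hk']
      simp [toReal]
  have hinj : Function.Injective fun α : Fin N →₀ ℕ => (k : ℝ)⁻¹ • toReal α :=
    (smul_right_injective _ (inv_ne_zero hk')).comp toReal_injective
  rw [himg, Nat.card_image_of_injective hinj, M]
  simp

/-- The lattice points of `kC` with positive coordinates all of whose neighbours in
`α + {-1, 0, 1}^N` also lie in `kC`. -/
def innerPoints (C : ConvexBody (Fin N → ℝ)) (k : ℕ) : Finset (Fin N →₀ ℕ) := by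
  classical
  exact (latticePoints C k).filter fun α =>
    (∀ i, 1 ≤ α i) ∧ ∀ γ : Fin N →₀ ℕ, (∀ i, γ i ≤ α i + 1 ∧ α i ≤ γ i + 1) →
      γ ∈ latticePoints C k

theorem mem_innerPoints {C : ConvexBody (Fin N → ℝ)} {k : ℕ} {α : Fin N →₀ ℕ} :
    α ∈ innerPoints C k ↔ α ∈ latticePoints C k ∧ (∀ i, 1 ≤ α i) ∧
      ∀ γ : Fin N →₀ ℕ, (∀ i, γ i ≤ α i + 1 ∧ α i ≤ γ i + 1) → γ ∈ latticePoints C k := by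
  simp [innerPoints]

theorem innerPoints_subset (C : ConvexBody (Fin N → ℝ)) (k : ℕ) :
    innerPoints C k ⊆ latticePoints C k := fun _ h => (mem_innerPoints.1 h).1

/-- Translation by `(1, …, 1)` maps `kC` into the inner points of `(k + 2N)C`, because
`{0, 1, 2}^N ⊆ 2N Σ ⊆ 2N C`. -/
theorem M_le_card_innerPoints {C : ConvexBody (Fin N → ℝ)}
    (hC : unitSimplex N ⊆ (C : Set (Fin N → ℝ))) (k : ℕ) :
    M C k ≤ (innerPoints C (k + 2 * N)).card := by
  let u : Fin N →₀ ℕ := Finsupp.equivFunOnFinite.symm fun _ => 1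
  refine Finset.card_le_card_of_injOn (fun α => α + u) ?_ (add_left_injective u).injOn
  intro α hα
  have key : ∀ γ : Fin N →₀ ℕ, (∀ i, γ i ≤ (α + u) i + 1 ∧ (α + u) i ≤ γ i + 1) →
      γ ∈ latticePoints C (k + 2 * N) := by
    intro γ hγ
    have h1 : ∀ i, α i ≤ γ i ∧ γ i ≤ α i + 2 := fun i => by
      have := hγ i
      simp only [u, Finsupp.add_apply, Finsupp.equivFunOnFinite_symm_apply_apply] at this
      omega
    have h2 : γ = α + (γ - α) := by
      ext i
      have := h1 i
      simp only [Finsupp.add_apply, Finsupp.tsub_apply]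
      omega
    rw [h2]
    refine add_mem_latticePoints hα (mem_latticePoints_of_sum_le hC ?_)
    calc ∑ i, (γ - α) i ≤ ∑ _i : Fin N, 2 := Finset.sum_le_sum fun i _ => by
          have := h1 i
          simp only [Finsupp.tsub_apply]
          omega
      _ = 2 * N := by simp [mul_comm]
  exact mem_innerPoints.2 ⟨key _ fun i => ⟨Nat.le_succ _, Nat.le_succ _⟩, fun i => by simp [u], key⟩

theorem tendsto_boundary_div_pow {C : ConvexBody (Fin N → ℝ)} (hC₀ : ∀ x ∈ C, ∀ i, 0 ≤ x i)
    (hC : unitSimplex N ⊆ (C : Set (Fin N → ℝ))) :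
    Tendsto (fun k : ℕ => ((M C k : ℝ) - (innerPoints C k).card) / (k : ℝ) ^ N) atTop (𝓝 0) := by
  have h1 := tendsto_M_div_pow C hC₀
  have h2 : Tendsto (fun k : ℕ => (M C (k - 2 * N) : ℝ) / (k : ℝ) ^ N) atTop
      (𝓝 (MeasureTheory.volume.real (C : Set (Fin N → ℝ)))) := by
    have h3 := h1.comp (tendsto_sub_atTop_nat (2 * N))
    have h4 : Tendsto (fun k : ℕ => (((k - 2 * N : ℕ) : ℝ) / k) ^ N) atTop (𝓝 1) := by
      have h5 : Tendsto (fun k : ℕ => 1 - (2 * N : ℝ) / k) atTop (𝓝 (1 - 0)) :=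
        tendsto_const_nhds.sub (tendsto_const_div_atTop_nhds_zero_nat _)
      have h6 := (h5.pow N)
      rw [sub_zero, one_pow] at h6
      refine h6.congr' ?_
      filter_upwards [eventually_gt_atTop (2 * N)] with k hk
      have hk' : (k : ℝ) ≠ 0 := by
        have : 0 < k := by omega
        exact_mod_cast this.ne'
      rw [Nat.cast_sub hk.le]
      push_cast
      rw [sub_div, div_self hk']
    have h7 := h3.mul h4
    rw [mul_one] at h7
    refine h7.congr' ?_
    filter_upwards [eventually_gt_atTop (2 * N)] with k hk
    have hk' : (k : ℝ) ≠ 0 := by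
      have : 0 < k := by omega
      exact_mod_cast this.ne'
    have hk2 : ((k - 2 * N : ℕ) : ℝ) ≠ 0 := by
      have : 0 < k - 2 * N := by omega
      exact_mod_cast this.ne'
    simp only [Function.comp]
    rw [div_pow]
    field_simp
  have h8 := h1.sub h2
  rw [sub_self] at h8
  refine squeeze_zero' (Eventually.of_forall fun k => ?_) ?_ h8
  · have : (innerPoints C k).card ≤ M C k := Finset.card_le_card (innerPoints_subset C k)
    have : ((innerPoints C k).card : ℝ) ≤ M C k := by exact_mod_cast this
    exact div_nonneg (by linarith) (by positivity)
  · filter_upwards [eventually_ge_atTop (2 * N)] with k hk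
    have h9 := M_le_card_innerPoints hC (k - 2 * N)
    rw [Nat.sub_add_cancel hk] at h9
    have h9' : (M C (k - 2 * N) : ℝ) ≤ (innerPoints C k).card := by exact_mod_cast h9
    rw [← sub_div]
    gcongr

theorem exists_le_M_half {C : ConvexBody (Fin N → ℝ)} (hC₀ : ∀ x ∈ C, ∀ i, 0 ≤ x i)
    (hC : unitSimplex N ⊆ (C : Set (Fin N → ℝ))) :
    ∃ c : ℝ, 0 < c ∧ ∀ᶠ k : ℕ in atTop, c * (k : ℝ) ^ N ≤ M C (k / 2) := by
  have hv := volume_pos C hC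
  set v := MeasureTheory.volume.real (C : Set (Fin N → ℝ))
  have h := (tendsto_M_div_pow C hC₀).eventually (lt_mem_nhds (half_lt_self hv))
  refine ⟨v / 2 * (1 / 4) ^ N, by positivity, ?_⟩
  filter_upwards [(Nat.tendsto_div_const_atTop (n := 2) (by norm_num)).eventually h,
    eventually_ge_atTop 4] with k hk hk4
  have hk2 : (0 : ℝ) < ((k / 2 : ℕ) : ℝ) := by
    have : 0 < k / 2 := by omega
    exact_mod_cast this
  rw [lt_div_iff₀ (by positivity)] at hk
  refine le_trans ?_ hk.le
  rw [mul_assoc, ← mul_pow]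
  have h4 : (1 / 4 * k : ℝ) ≤ ((k / 2 : ℕ) : ℝ) := by
    have : k ≤ 4 * (k / 2) := by omega
    have : (k : ℝ) ≤ 4 * ((k / 2 : ℕ) : ℝ) := by exact_mod_cast this
    linarith
  gcongr

theorem exists_M_le {C : ConvexBody (Fin N → ℝ)} (hC₀ : ∀ x ∈ C, ∀ i, 0 ≤ x i) :
    ∃ c : ℝ, 0 < c ∧ ∀ k : ℕ, 0 < k → (M C k : ℝ) ≤ c * (k : ℝ) ^ N := by
  obtain ⟨c, hc⟩ := (tendsto_M_div_pow C hC₀).bddAbove_range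
  refine ⟨max c 1, by positivity, fun k hk => ?_⟩
  have h := hc (Set.mem_range_self k)
  have hk' : (0 : ℝ) < k := by exact_mod_cast hk
  rw [← div_le_iff₀ (by positivity)]
  exact h.trans (le_max_left _ _)

/-! ### The order `≺_C` and the lattice points of `kC` -/

theorem radius_nonneg (C : ConvexBody (Fin N → ℝ)) (α : Fin N →₀ ℕ) : 0 ≤ radius C α :=
  Real.sInf_nonneg fun _ hr => hr.1

theorem mem_latticePoints_iff_radius_le {C : ConvexBody (Fin N → ℝ)}
    (hC : unitSimplex N ⊆ (C : Set (Fin N → ℝ))) {k : ℕ} {α : Fin N →₀ ℕ} :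
    α ∈ latticePoints C k ↔ radius C α ≤ k := by
  constructor
  · intro h
    obtain ⟨x, hx, hxα⟩ := mem_latticePoints.1 h
    exact csInf_le ⟨0, fun r hr => hr.1⟩ ⟨by positivity, x, hx, hxα⟩
  · intro h
    have hne : {r : ℝ | 0 ≤ r ∧ toReal α ∈ r • (C : Set (Fin N → ℝ))}.Nonempty := by
      obtain ⟨x, hx, hxα⟩ := mem_latticePoints.1
        (mem_latticePoints_of_sum_le hC (α := α) le_rfl)
      exact ⟨_, by positivity, x, hx, hxα⟩
    have hex : ∀ n : ℕ, ∃ p : ℝ × (Fin N → ℝ), p ∈ Set.Icc 0 ((k : ℝ) + 1 / (n + 1)) ×ˢ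
        (C : Set (Fin N → ℝ)) ∧ p.1 • p.2 = toReal α := by
      intro n
      obtain ⟨r, ⟨hr0, x, hx, hxα⟩, hr⟩ := exists_lt_of_csInf_lt hne
        (show sInf _ < (k : ℝ) + 1 / (n + 1) from
          lt_of_le_of_lt h (lt_add_of_pos_right _ (by positivity)))
      exact ⟨(r, x), ⟨⟨hr0, hr.le⟩, hx⟩, hxα⟩
    choose p hp hpα using hex
    have hcomp : IsCompact (Set.Icc (0 : ℝ) (k + 1) ×ˢ (C : Set (Fin N → ℝ))) :=
      isCompact_Icc.prod C.isCompact
    obtain ⟨q, hq, φ, hφ, hlim⟩ := hcomp.tendsto_subseq (x := p) fun n =>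
      ⟨⟨(hp n).1.1, (hp n).1.2.trans (by
        gcongr
        rw [div_le_one (by positivity)]
        linarith [(Nat.cast_nonneg n : (0 : ℝ) ≤ n)])⟩, (hp n).2⟩
    have hq1 : q.1 ≤ k := by
      have h1 : Tendsto (fun n => (p (φ n)).1) atTop (𝓝 q.1) :=
        (continuous_fst.tendsto q).comp hlim
      have h2 : Tendsto (fun n : ℕ => (k : ℝ) + 1 / ((φ n : ℕ) + 1)) atTop (𝓝 (k + 0)) :=
        tendsto_const_nhds.add
          (tendsto_one_div_add_atTop_nhds_zero_nat.comp hφ.tendsto_atTop)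
      rw [add_zero] at h2
      exact le_of_tendsto_of_tendsto' h1 h2 fun n => (hp (φ n)).1.2
    have hqα : q.1 • q.2 = toReal α := by
      have h1 : Tendsto (fun n => (p (φ n)).1 • (p (φ n)).2) atTop (𝓝 (q.1 • q.2)) :=
        ((continuous_fst.smul continuous_snd).tendsto q).comp hlim
      simp only [hpα] at h1
      exact tendsto_nhds_unique h1 tendsto_const_nhds
    have h0 : (0 : Fin N → ℝ) ∈ (C : Set (Fin N → ℝ)) := hC ⟨by simp, by simp⟩
    rcases (hq.1.1 : (0 : ℝ) ≤ q.1).eq_or_lt with hz | hpos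
    · exact mem_latticePoints.2 ⟨0, h0, by rw [← hqα, ← hz]; simp⟩
    · have hk : (0 : ℝ) < k := hpos.trans_le hq1
      refine mem_latticePoints.2 ⟨(q.1 / k) • q.2,
        C.convex.smul_mem_of_zero_mem h0 hq.2 ⟨by positivity, div_le_one_of_le₀ hq1 hk.le⟩, ?_⟩
      rw [smul_smul, mul_div_cancel₀ _ hk.ne', hqα]

theorem IsEnumeration.zero {C : ConvexBody (Fin N → ℝ)}
    (hC : unitSimplex N ⊆ (C : Set (Fin N → ℝ))) {a : ℕ → Fin N →₀ ℕ}
    (ha : IsEnumeration C a) : a 0 = 0 := by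
  obtain ⟨i, hi⟩ := ha.bijective.2 0
  rcases Nat.eq_zero_or_pos i with rfl | hpos
  · exact hi
  · exfalso
    have h := ha.increasing 0 i hpos
    rw [hi] at h
    have h0 : radius C 0 ≤ 0 := by
      simpa using (mem_latticePoints_iff_radius_le hC (k := 0)).1
        (mem_latticePoints_of_sum_le hC (α := 0) (by simp))
    rcases h with h | ⟨-, h | ⟨-, j, hj, -⟩⟩
    · linarith [radius_nonneg C (a 0)]
    · simp at h
    · simp at hj

/-- The first `M_k` terms of the enumeration are exactly the lattice points of `kC`. -/
theorem IsEnumeration.mem_latticePoints_iff {C : ConvexBody (Fin N → ℝ)}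
    (hC : unitSimplex N ⊆ (C : Set (Fin N → ℝ))) {a : ℕ → Fin N →₀ ℕ}
    (ha : IsEnumeration C a) (k i : ℕ) : a i ∈ latticePoints C k ↔ i < M C k := by
  classical
  have hmono : ∀ i j, i ≤ j → a j ∈ latticePoints C k → a i ∈ latticePoints C k := by
    intro i j hij hj
    rcases hij.eq_or_lt with rfl | hlt
    · exact hj
    · rw [mem_latticePoints_iff_radius_le hC] at *
      rcases ha.increasing i j hlt with h | h
      · linarith
      · linarith [h.1]
  let e := Equiv.ofBijective a ha.bijective
  let s : Finset ℕ := (latticePoints C k).map e.symm.toEmbedding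
  have hs : ∀ i, i ∈ s ↔ a i ∈ latticePoints C k := by
    intro i
    simp only [s, Finset.mem_map_equiv, Equiv.symm_symm]
    rfl
  have hcard : s.card = M C k := Finset.card_map _
  rw [← hs, ← hcard]
  constructor
  · intro hi
    have hsub : Finset.range (i + 1) ⊆ s := fun j hj =>
      (hs j).2 (hmono j i (by simpa [Nat.lt_succ_iff] using hj) ((hs i).1 hi))
    have := Finset.card_le_card hsub
    rw [Finset.card_range] at this
    omega
  · intro hi
    by_contra hn
    have hsub : s ⊆ Finset.range i := fun j hj => by
      rw [Finset.mem_range]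
      by_contra hji
      exact hn ((hs i).2 (hmono i j (by omega) ((hs j).1 hj)))
    have := Finset.card_le_card hsub
    rw [Finset.card_range] at this
    omega

/-! ### Averages of subadditive functions over lattice points -/

/-- Hermite's identity for natural numbers. -/
theorem sum_range_add_div (j b : ℕ) (hj : 0 < j) : ∑ i ∈ Finset.range j, (b + i) / j = b := by
  induction b with
  | zero =>
    refine Finset.sum_eq_zero fun i hi => ?_
    rw [zero_add]
    exact Nat.div_eq_of_lt (Finset.mem_range.1 hi)
  | succ b ih =>
    have h1 := Finset.sum_range_succ (fun i => (b + i) / j) j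
    have h2 := Finset.sum_range_succ' (fun i => (b + i) / j) j
    have h3 : (b + j) / j = b / j + 1 := Nat.add_div_right b hj
    have h4 : ∀ i, b + 1 + i = b + (i + 1) := fun i => by ring
    simp only [h4]
    simp only [add_zero] at h2
    omega

/-- The coordinatewise quotient `⌊(β + (i, …, i)) / j⌋`. -/
def shiftDiv (j i : ℕ) (β : Fin N →₀ ℕ) : Fin N →₀ ℕ :=
  Finsupp.equivFunOnFinite.symm fun s => (β s + i) / j

@[simp] theorem shiftDiv_apply (j i : ℕ) (β : Fin N →₀ ℕ) (s : Fin N) :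
    shiftDiv j i β s = (β s + i) / j := rfl

theorem sum_shiftDiv {j : ℕ} (hj : 0 < j) (β : Fin N →₀ ℕ) :
    ∑ i ∈ Finset.range j, shiftDiv j i β = β := by
  ext s
  rw [Finsupp.finsetSum_apply]
  exact sum_range_add_div j (β s) hj

section Subadditive

variable {C : ConvexBody (Fin N → ℝ)} {G : ℕ → (Fin N →₀ ℕ) → ℝ}

theorem apply_sum_le (hC : unitSimplex N ⊆ (C : Set (Fin N → ℝ)))
    (hG₀ : ∀ k, ∀ α ∈ latticePoints C k, G k α ≤ 0)
    (hadd : ∀ k l, ∀ α ∈ latticePoints C k, ∀ β ∈ latticePoints C l,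
      G (k + l) (α + β) ≤ G k α + G l β)
    (k : ℕ) (f : ℕ → Fin N →₀ ℕ) (j : ℕ) (hf : ∀ i < j, f i ∈ latticePoints C k) :
    ∑ i ∈ Finset.range j, f i ∈ latticePoints C (j * k) ∧
      G (j * k) (∑ i ∈ Finset.range j, f i) ≤ ∑ i ∈ Finset.range j, G k (f i) := by
  induction j with
  | zero =>
    have h0 : (0 : Fin N →₀ ℕ) ∈ latticePoints C 0 := mem_latticePoints_of_sum_le hC (by simp)
    simpa using ⟨h0, hG₀ 0 0 h0⟩
  | succ j ih =>
    obtain ⟨h1, h2⟩ := ih fun i hi => hf i (by omega)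
    have h3 := hf j (by omega)
    rw [Finset.sum_range_succ, Finset.sum_range_succ, add_mul, one_mul]
    exact ⟨add_mem_latticePoints h1 h3, (hadd _ _ _ h1 _ h3).trans (by linarith)⟩

theorem pow_le_card_fiber_shiftDiv {k j i : ℕ} (hij : i < j)
    {α : Fin N →₀ ℕ} (hα : α ∈ innerPoints C k) (s : Finset (Fin N →₀ ℕ))
    (hs : ∀ β, (∀ i' < j, shiftDiv j i' β ∈ latticePoints C k) → β ∈ s) :
    j ^ N ≤ (s.filter fun β => shiftDiv j i β = α).card := by
  obtain ⟨-, hpos, hnb⟩ := mem_innerPoints.1 hα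
  let Φ : (Fin N → Fin j) → (Fin N →₀ ℕ) := fun f =>
    Finsupp.equivFunOnFinite.symm fun t => j * α t - i + f t
  have hΦ : ∀ f t, Φ f t + i = j * α t + f t := by
    intro f t
    have h1 : j ≤ j * α t := Nat.le_mul_of_pos_right j (hpos t)
    change j * α t - i + f t + i = _
    omega
  have hcard : (Finset.univ : Finset (Fin N → Fin j)).card = j ^ N := by simp
  rw [← hcard]
  refine Finset.card_le_card_of_injOn Φ ?_ ?_
  · intro f _
    rw [Finset.mem_coe, Finset.mem_filter]
    constructor
    · refine hs _ fun i' hi' => hnb _ fun t => ?_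
      have h1 := hΦ f t
      have h2 := (f t).2
      have h3 : j * (α t - 1) + j = j * α t := by
        rw [← Nat.mul_succ, Nat.succ_eq_add_one, Nat.sub_add_cancel (hpos t)]
      constructor
      · rw [shiftDiv_apply, ← Nat.lt_succ_iff, Nat.div_lt_iff_lt_mul (by omega),
          Nat.succ_eq_add_one, mul_comm, mul_add, mul_add]
        omega
      · have h4 : α t - 1 ≤ shiftDiv j i' (Φ f) t := by
          rw [shiftDiv_apply, Nat.le_div_iff_mul_le (by omega), mul_comm]
          omega
        omega
    · ext t
      rw [shiftDiv_apply, hΦ, Nat.mul_add_div (by omega), Nat.div_eq_of_lt (f t).2, add_zero]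
  · intro f _ g _ hfg
    ext t
    have h1 := hΦ f t
    have h2 := hΦ g t
    have h3 : Φ f t = Φ g t := by rw [hfg]
    omega

/-- Summing subadditivity over `β = ∑_{i < j} ⌊(β + i) / j⌋`, where for each `i` every inner point
of `kC` occurs as a summand for `j ^ N` choices of `β`. -/
theorem sum_mul_le (hC : unitSimplex N ⊆ (C : Set (Fin N → ℝ)))
    (hG₀ : ∀ k, ∀ α ∈ latticePoints C k, G k α ≤ 0)
    (hadd : ∀ k l, ∀ α ∈ latticePoints C k, ∀ β ∈ latticePoints C l,
      G (k + l) (α + β) ≤ G k α + G l β) (k j : ℕ) (hj : 0 < j) :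
    ∑ β ∈ latticePoints C (j * k), G (j * k) β ≤
      (j : ℝ) ^ (N + 1) * ∑ α ∈ innerPoints C k, G k α := by
  classical
  set good := (latticePoints C (j * k)).filter
    fun β => ∀ i < j, shiftDiv j i β ∈ latticePoints C k with hgood
  have hmem : ∀ β, (∀ i < j, shiftDiv j i β ∈ latticePoints C k) → β ∈ good := by
    intro β hβ
    rw [hgood, Finset.mem_filter]
    refine ⟨?_, hβ⟩
    have := (apply_sum_le hC hG₀ hadd k (fun i => shiftDiv j i β) j hβ).1
    rwa [sum_shiftDiv hj] at this
  have hfib : ∀ i < j, ∑ β ∈ good, G k (shiftDiv j i β) ≤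
      (j : ℝ) ^ N * ∑ α ∈ innerPoints C k, G k α := by
    intro i hi
    have hmaps : ∀ β ∈ good, shiftDiv j i β ∈ latticePoints C k := fun β hβ =>
      (Finset.mem_filter.1 hβ).2 i hi
    rw [← Finset.sum_fiberwise_of_maps_to hmaps]
    have h1 : ∀ α ∈ latticePoints C k,
        ∑ β ∈ good with shiftDiv j i β = α, G k (shiftDiv j i β) =
          (good.filter fun β => shiftDiv j i β = α).card * G k α := by
      intro α _
      rw [← nsmul_eq_mul, ← Finset.sum_const]
      refine Finset.sum_congr rfl fun β hβ => ?_
      rw [(Finset.mem_filter.1 hβ).2]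
    rw [Finset.sum_congr rfl h1, Finset.mul_sum,
      ← Finset.sum_sdiff (innerPoints_subset C k)]
    have h2 : ∑ α ∈ latticePoints C k \ innerPoints C k,
        ((good.filter fun β => shiftDiv j i β = α).card : ℝ) * G k α ≤ 0 :=
      Finset.sum_nonpos fun α hα => mul_nonpos_of_nonneg_of_nonpos (by positivity)
        (hG₀ k α (Finset.mem_sdiff.1 hα).1)
    have h3 : ∑ α ∈ innerPoints C k,
        ((good.filter fun β => shiftDiv j i β = α).card : ℝ) * G k α ≤
          ∑ α ∈ innerPoints C k, (j : ℝ) ^ N * G k α := by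
      refine Finset.sum_le_sum fun α hα => ?_
      refine mul_le_mul_of_nonpos_right ?_ (hG₀ k α (innerPoints_subset C k hα))
      exact_mod_cast pow_le_card_fiber_shiftDiv hi hα good hmem
    linarith
  calc ∑ β ∈ latticePoints C (j * k), G (j * k) β
      ≤ ∑ β ∈ good, G (j * k) β := by
        have hsub : good ⊆ latticePoints C (j * k) := Finset.filter_subset _ _
        rw [← Finset.sum_sdiff hsub]
        have : ∑ β ∈ latticePoints C (j * k) \ good, G (j * k) β ≤ 0 :=
          Finset.sum_nonpos fun β hβ => hG₀ _ β (Finset.mem_sdiff.1 hβ).1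
        linarith
    _ ≤ ∑ β ∈ good, ∑ i ∈ Finset.range j, G k (shiftDiv j i β) := by
        refine Finset.sum_le_sum fun β hβ => ?_
        have := (apply_sum_le hC hG₀ hadd k (fun i => shiftDiv j i β) j
          (Finset.mem_filter.1 hβ).2).2
        rwa [sum_shiftDiv hj] at this
    _ = ∑ i ∈ Finset.range j, ∑ β ∈ good, G k (shiftDiv j i β) := Finset.sum_comm
    _ ≤ ∑ _i ∈ Finset.range j, (j : ℝ) ^ N * ∑ α ∈ innerPoints C k, G k α :=
        Finset.sum_le_sum fun i hi => hfib i (Finset.mem_range.1 hi)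
    _ = _ := by
        rw [Finset.sum_const, Finset.card_range, nsmul_eq_mul]
        ring

theorem sum_le_sum_of_le (hC : unitSimplex N ⊆ (C : Set (Fin N → ℝ)))
    (hG₀ : ∀ k, ∀ α ∈ latticePoints C k, G k α ≤ 0)
    (hadd : ∀ k l, ∀ α ∈ latticePoints C k, ∀ β ∈ latticePoints C l,
      G (k + l) (α + β) ≤ G k α + G l β) {m n : ℕ} (hmn : m ≤ n) :
    ∑ β ∈ latticePoints C n, G n β ≤ ∑ β ∈ latticePoints C m, G m β := by
  have h0 : (0 : Fin N →₀ ℕ) ∈ latticePoints C (n - m) := mem_latticePoints_of_sum_le hC (by simp)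
  rw [← Finset.sum_sdiff (latticePoints_mono hC hmn)]
  have h1 : ∑ β ∈ latticePoints C n \ latticePoints C m, G n β ≤ 0 :=
    Finset.sum_nonpos fun β hβ => hG₀ _ β (Finset.mem_sdiff.1 hβ).1
  have h2 : ∑ β ∈ latticePoints C m, G n β ≤ ∑ β ∈ latticePoints C m, G m β := by
    refine Finset.sum_le_sum fun β hβ => ?_
    have h3 := hadd m (n - m) β hβ 0 h0
    rw [Nat.add_sub_cancel' hmn, add_zero] at h3
    linarith [hG₀ _ _ h0]
  linarith

/-- A subadditive function on the graded lattice points with `-A k ≤ G k α ≤ 0` has convergent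
normalized sums `k^{-(N+1)} ∑_{α ∈ kC} G k α`: the limit is the infimum of the corresponding
expressions for the inner points, as in Fekete's lemma. -/
theorem exists_tendsto_sum_div_pow (hC₀ : ∀ x ∈ C, ∀ i, 0 ≤ x i)
    (hC : unitSimplex N ⊆ (C : Set (Fin N → ℝ)))
    (hG₀ : ∀ k, ∀ α ∈ latticePoints C k, G k α ≤ 0)
    (hadd : ∀ k l, ∀ α ∈ latticePoints C k, ∀ β ∈ latticePoints C l,
      G (k + l) (α + β) ≤ G k α + G l β)
    (A : ℝ) (hA : 0 ≤ A) (hGA : ∀ k, ∀ α ∈ latticePoints C k, -(A * k) ≤ G k α) :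
    ∃ ℓ : ℝ, Tendsto (fun k : ℕ => (∑ α ∈ latticePoints C k, G k α) / (k : ℝ) ^ (N + 1))
      atTop (𝓝 ℓ) := by
  set S : ℕ → ℝ := fun k => ∑ α ∈ latticePoints C k, G k α
  set I : ℕ → ℝ := fun k => ∑ α ∈ innerPoints C k, G k α
  set b : ℕ → ℝ := fun k => A * (((M C k : ℝ) - (innerPoints C k).card) / (k : ℝ) ^ N)
  have hb : Tendsto b atTop (𝓝 0) := by
    simpa using (tendsto_boundary_div_pow hC₀ hC).const_mul A
  -- The boundary points contribute at most `A k` each.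
  have hIS : ∀ k, 0 < k → I k / (k : ℝ) ^ (N + 1) - b k ≤ S k / (k : ℝ) ^ (N + 1) := by
    intro k hk
    have hk' : (0 : ℝ) < k := by exact_mod_cast hk
    have h1 : S k = ∑ α ∈ latticePoints C k \ innerPoints C k, G k α + I k :=
      (Finset.sum_sdiff (innerPoints_subset C k)).symm
    have h2 : ∑ _α ∈ latticePoints C k \ innerPoints C k, (-(A * k)) ≤
        ∑ α ∈ latticePoints C k \ innerPoints C k, G k α :=
      Finset.sum_le_sum fun α hα => hGA k α (Finset.mem_sdiff.1 hα).1
    rw [Finset.sum_const, nsmul_eq_mul, Finset.card_sdiff_of_subset (innerPoints_subset C k),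
      Nat.cast_sub (Finset.card_le_card (innerPoints_subset C k))] at h2
    change ((M C k : ℝ) - _) * _ ≤ _ at h2
    have h3 : b k = (A * k * ((M C k : ℝ) - (innerPoints C k).card)) / (k : ℝ) ^ (N + 1) := by
      simp only [b]
      rw [pow_succ]
      field_simp
    rw [h3, ← sub_div]
    gcongr
    linarith
  have hbdd : BddBelow ((fun k => I k / (k : ℝ) ^ (N + 1)) '' Set.Ioi 0) := by
    obtain ⟨c, hc, hcM⟩ := exists_M_le hC₀ (C := C)
    refine ⟨-(A * c), ?_⟩
    rintro _ ⟨k, hk, rfl⟩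
    have hk' : (0 : ℝ) < k := by exact_mod_cast hk
    have h1 : ∑ _α ∈ innerPoints C k, (-(A * k)) ≤ I k :=
      Finset.sum_le_sum fun α hα => hGA k α (innerPoints_subset C k hα)
    rw [Finset.sum_const, nsmul_eq_mul] at h1
    have h2 : ((innerPoints C k).card : ℝ) ≤ c * (k : ℝ) ^ N := by
      refine le_trans ?_ (hcM k hk)
      exact_mod_cast Finset.card_le_card (innerPoints_subset C k)
    change _ ≤ I k / (k : ℝ) ^ (N + 1)
    rw [le_div_iff₀ (by positivity)]
    have h3 : ((innerPoints C k).card : ℝ) * (A * k) ≤ c * (k : ℝ) ^ N * (A * k) := by gcongr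
    calc -(A * c) * (k : ℝ) ^ (N + 1) = -(c * (k : ℝ) ^ N * (A * k)) := by ring
      _ ≤ _ := by linarith
  have hne : ((fun k => I k / (k : ℝ) ^ (N + 1)) '' Set.Ioi 0).Nonempty :=
    ⟨_, 1, by simp, rfl⟩
  set ℓ := sInf ((fun k => I k / (k : ℝ) ^ (N + 1)) '' Set.Ioi 0)
  refine ⟨ℓ, tendsto_order.2 ⟨fun x hx => ?_, fun x hx => ?_⟩⟩
  · have h1 : ∀ᶠ k in atTop, b k < ℓ - x := hb.eventually (gt_mem_nhds (by linarith))
    filter_upwards [h1, eventually_gt_atTop 0] with k hk hk0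
    have h2 : ℓ ≤ I k / (k : ℝ) ^ (N + 1) := csInf_le hbdd ⟨k, hk0, rfl⟩
    linarith [hIS k hk0]
  · obtain ⟨_, ⟨k, hk, rfl⟩, hkx⟩ := exists_lt_of_csInf_lt hne hx
    have hk0 : 0 < k := hk
    have hk' : (0 : ℝ) < k := by exact_mod_cast hk0
    have hlim : Tendsto (fun n : ℕ => (((n / k : ℕ) : ℝ) / n) ^ (N + 1) * I k) atTop
        (𝓝 ((1 / k : ℝ) ^ (N + 1) * I k)) := by
      refine Tendsto.mul_const _ (Tendsto.pow ?_ _)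
      have h1 := (tendsto_nat_floor_mul_div_atTop (R := ℝ) (a := 1 / k) (by positivity)).comp
        (tendsto_natCast_atTop_atTop (R := ℝ))
      refine h1.congr fun n => ?_
      simp only [Function.comp]
      rw [one_div_mul_eq_div, Nat.floor_div_eq_div]
    have hx' : (1 / k : ℝ) ^ (N + 1) * I k < x := by
      have : (1 / k : ℝ) ^ (N + 1) * I k = I k / (k : ℝ) ^ (N + 1) := by
        rw [div_pow, one_pow, one_div_mul_eq_div]
      rw [this]
      exact hkx
    filter_upwards [hlim.eventually (gt_mem_nhds hx'), eventually_ge_atTop k] with n hn hkn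
    refine lt_of_le_of_lt ?_ hn
    have hn0 : (0 : ℝ) < n := hk'.trans_le (by exact_mod_cast hkn)
    have h1 : S n ≤ S (n / k * k) := sum_le_sum_of_le hC hG₀ hadd (Nat.div_mul_le_self n k)
    have h2 : S (n / k * k) ≤ ((n / k : ℕ) : ℝ) ^ (N + 1) * I k :=
      sum_mul_le hC hG₀ hadd k (n / k) (Nat.div_pos hkn hk0)
    rw [div_pow, div_mul_eq_mul_div]
    gcongr
    exact h1.trans h2

end Subadditive

/-! ### Monomial determinants and monic polynomials -/

/-- The monomial function `z ↦ z^α`. -/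
def evalMonomial (α : Fin N →₀ ℕ) (z : Fin N → ℂ) : ℂ := ∏ i, z i ^ α i

/-- The unweighted Vandermonde determinant `det [ζ_l^{a_j}]`. -/
def monomialDet {ι : Type*} [Fintype ι] [DecidableEq ι] (a : ι → Fin N →₀ ℕ)
    (ζ : ι → Fin N → ℂ) : ℂ :=
  Matrix.det (Matrix.of fun j l : ι => evalMonomial (a j) (ζ l))

theorem vdm_one {ι : Type*} [Fintype ι] [DecidableEq ι] (k : ℕ) (a : ι → Fin N →₀ ℕ)
    (ζ : ι → Fin N → ℂ) : vdm (fun _ => 1) k a ζ = monomialDet a ζ := by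
  simp [vdm, monomialDet, evalMonomial]

theorem monomialDet_comp_equiv {ι κ : Type*} [Fintype ι] [DecidableEq ι] [Fintype κ]
    [DecidableEq κ] (e : ι ≃ κ) (a : κ → Fin N →₀ ℕ) (ζ : κ → Fin N → ℂ) :
    monomialDet (a ∘ e) (ζ ∘ e) = monomialDet a ζ :=
  Matrix.det_submatrix_equiv_self e (Matrix.of fun j l : κ => evalMonomial (a j) (ζ l))

theorem norm_evalMonomial_le {R : ℝ} (α : Fin N →₀ ℕ) {z : Fin N → ℂ}
    (hz : ‖z‖ ≤ R) : ‖evalMonomial α z‖ ≤ R ^ ∑ i, α i := by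
  rw [evalMonomial, norm_prod, ← Finset.prod_pow_eq_pow_sum]
  refine Finset.prod_le_prod (fun i _ => norm_nonneg _) fun i _ => ?_
  rw [norm_pow]
  gcongr
  exact (norm_le_pi_norm z i).trans hz

theorem norm_det_le_factorial_mul_prod {ι : Type*} [Fintype ι] [DecidableEq ι]
    (A : Matrix ι ι ℂ) (b : ι → ℝ) (h : ∀ j l, ‖A j l‖ ≤ b j) :
    ‖A.det‖ ≤ (Fintype.card ι).factorial * ∏ j, b j := by
  rw [Matrix.det_apply]
  calc _ ≤ ∑ σ : Equiv.Perm ι, ‖Equiv.Perm.sign σ • ∏ i, A (σ i) i‖ := norm_sum_le _ _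
    _ ≤ ∑ _σ : Equiv.Perm ι, ∏ j, b j := by
      refine Finset.sum_le_sum fun σ _ => ?_
      have h1 : ‖Equiv.Perm.sign σ • ∏ i, A (σ i) i‖ = ‖∏ i, A (σ i) i‖ := by
        rcases Int.units_eq_one_or (Equiv.Perm.sign σ) with h | h <;> simp [h]
      rw [h1, norm_prod, ← Equiv.prod_comp σ b]
      exact Finset.prod_le_prod (fun i _ => norm_nonneg _) fun i _ => h _ _
    _ = _ := by
      rw [Finset.sum_const, Finset.card_univ, Fintype.card_perm, nsmul_eq_mul]

/-- `b` bounds on `K` some function `z^{a j} + ∑_{i < j} c i z^{a i}`. -/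
def HasMonicBound (a : ℕ → Fin N →₀ ℕ) (K : Set (Fin N → ℂ)) (j : ℕ) (b : ℝ) : Prop :=
  ∃ c : ℕ → ℂ, c j = 1 ∧
    ∀ z ∈ K, ‖∑ i ∈ Finset.range (j + 1), c i * evalMonomial (a i) z‖ ≤ b

theorem hasMonicBound_of_norm_le {a : ℕ → Fin N →₀ ℕ} {K : Set (Fin N → ℂ)} {R : ℝ}
    (hR : ∀ z ∈ K, ‖z‖ ≤ R) (j : ℕ) : HasMonicBound a K j (R ^ ∑ i, a j i) := by
  refine ⟨fun i => if i = j then 1 else 0, by simp, fun z hz => ?_⟩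
  simpa using norm_evalMonomial_le (a j) (hR z hz)

/-- Unitriangular row operations replace the monomials by arbitrary monic polynomials, whence a
bound for the determinant by Leibniz' formula. -/
theorem norm_monomialDet_le {a : ℕ → Fin N →₀ ℕ} {K : Set (Fin N → ℂ)} {n : ℕ} {b : ℕ → ℝ}
    (hb : ∀ j < n, HasMonicBound a K j (b j)) (ζ : Fin n → Fin N → ℂ) (hζ : ∀ l, ζ l ∈ K) :
    ‖monomialDet (fun j : Fin n => a j) ζ‖ ≤ n.factorial * ∏ j ∈ Finset.range n, b j := by
  choose c hc1 hc2 using fun j : Fin n => hb j j.2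
  let T : Matrix (Fin n) (Fin n) ℂ := Matrix.of fun j i => if i ≤ j then c j i else 0
  let V : Matrix (Fin n) (Fin n) ℂ := Matrix.of fun j l => evalMonomial (a j) (ζ l)
  have hT : T.det = 1 := by
    rw [Matrix.det_of_isLowerTriangular T]
    · exact Finset.prod_eq_one fun j _ => by simp [T, hc1]
    · intro j i hij
      have : ¬ i ≤ j := not_le.2 hij
      simp [T, this]
  have hTV : ∀ j l, (T * V) j l =
      ∑ i ∈ Finset.range (j + 1), c j i * evalMonomial (a i) (ζ l) := by
    intro j l
    rw [Matrix.mul_apply]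
    have h1 : ∀ i : Fin n, T j i * V i l =
        if (i : ℕ) ≤ j then c j i * evalMonomial (a i) (ζ l) else 0 := fun i => by
      change (if i ≤ j then c j i else 0) * evalMonomial (a i) (ζ l) = _
      rw [ite_mul, zero_mul]
      rfl
    rw [Finset.sum_congr rfl fun i _ => h1 i, Fin.sum_univ_eq_sum_range
      (fun i : ℕ => if i ≤ j then c j i * evalMonomial (a i) (ζ l) else 0), ← Finset.sum_filter]
    refine Finset.sum_congr ?_ fun _ _ => rfl
    ext i
    have := j.2
    simp only [Finset.mem_filter, Finset.mem_range]
    omega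
  have hdet : monomialDet (fun j : Fin n => a j) ζ = (T * V).det := by
    rw [Matrix.det_mul, hT, one_mul]
    rfl
  rw [hdet, ← Fin.prod_univ_eq_prod_range]
  simpa using norm_det_le_factorial_mul_prod (T * V) (fun j => b j) fun j l => by
    rw [hTV]
    exact hc2 j _ (hζ l)

/-- As a function of its last point, a Vandermonde determinant is a combination of the monomials
whose leading coefficient is the determinant for the previous points. -/
theorem exists_monomialDet_snoc (a : ℕ → Fin N →₀ ℕ) {n : ℕ} (ζ : Fin n → Fin N → ℂ) :
    ∃ c : ℕ → ℂ, c n = monomialDet (fun j : Fin n => a j) ζ ∧ ∀ η : Fin N → ℂ,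
      monomialDet (fun j : Fin (n + 1) => a j) (Fin.snoc ζ η : Fin (n + 1) → Fin N → ℂ) =
        ∑ i ∈ Finset.range (n + 1), c i * evalMonomial (a i) η := by
  let c' : Fin (n + 1) → ℂ := fun i => (-1) ^ (i + n : ℕ) *
    Matrix.det (Matrix.of fun (j l : Fin n) => evalMonomial (a (i.succAbove j)) (ζ l))
  refine ⟨fun i => if h : i < n + 1 then c' ⟨i, h⟩ else 0, ?_, fun η => ?_⟩
  · have h1 : (⟨n, Nat.lt_succ_self n⟩ : Fin (n + 1)) = Fin.last n := rfl
    beta_reduce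
    rw [dif_pos (Nat.lt_succ_self n), h1]
    simp only [c', Fin.val_last, ← two_mul, pow_mul, neg_one_sq, one_pow, one_mul,
      Fin.succAbove_last, Fin.val_castSucc]
    rfl
  · rw [monomialDet, Matrix.det_succ_column _ (Fin.last n), ← Fin.sum_univ_eq_sum_range
      (fun i => (if h : i < n + 1 then c' ⟨i, h⟩ else 0) * evalMonomial (a i) η)]
    refine Finset.sum_congr rfl fun i _ => ?_
    have h2 : (Matrix.of fun j l : Fin (n + 1) => evalMonomial (a j)
        ((Fin.snoc ζ η : Fin (n + 1) → Fin N → ℂ) l)).submatrix i.succAbove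
          (Fin.last n).succAbove =
        Matrix.of fun (j l : Fin n) => evalMonomial (a (i.succAbove j)) (ζ l) := by
      ext j l
      simp
    rw [h2, dif_pos i.2]
    simp only [c', Matrix.of_apply, Fin.snoc_last, Fin.val_last, Fin.eta]
    ring

/-- If the determinant of the first `n` points does not vanish, dividing by it produces a monic
polynomial. -/
theorem hasMonicBound_of_snoc {a : ℕ → Fin N →₀ ℕ} {K : Set (Fin N → ℂ)} {n : ℕ}
    {ζ : Fin n → Fin N → ℂ} (hD : monomialDet (fun j : Fin n => a j) ζ ≠ 0) {B : ℝ}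
    (hB : ∀ η ∈ K, ‖monomialDet (fun j : Fin (n + 1) => a j)
      (Fin.snoc ζ η : Fin (n + 1) → Fin N → ℂ)‖ ≤ B) :
    HasMonicBound a K n (B / ‖monomialDet (fun j : Fin n => a j) ζ‖) := by
  obtain ⟨c, hc, hexp⟩ := exists_monomialDet_snoc a ζ
  refine ⟨fun i => c i / monomialDet (fun j : Fin n => a j) ζ, by
    beta_reduce
    rw [hc, div_self hD],
    fun z hz => ?_⟩
  have h1 : ∑ i ∈ Finset.range (n + 1), c i / monomialDet (fun j : Fin n => a j) ζ *
      evalMonomial (a i) z = (∑ i ∈ Finset.range (n + 1), c i * evalMonomial (a i) z) /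
        monomialDet (fun j : Fin n => a j) ζ := by
    rw [Finset.sum_div]
    exact Finset.sum_congr rfl fun i _ => by ring
  rw [h1, ← hexp, norm_div]
  gcongr
  exact hB z hz

theorem continuous_evalMonomial (α : Fin N →₀ ℕ) : Continuous (evalMonomial α) := by
  unfold evalMonomial
  fun_prop

/-- Choosing the points one after the other so as to maximize the determinant. -/
theorem exists_prod_le_norm_monomialDet {a : ℕ → Fin N →₀ ℕ} {K : Set (Fin N → ℂ)}
    (hK : IsCompact K) (hne : K.Nonempty) {t : ℕ → ℝ} (n : ℕ) (ht₀ : ∀ j < n, 0 ≤ t j)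
    (ht : ∀ j < n, ∀ b, HasMonicBound a K j b → t j ≤ b) :
    ∃ ζ : Fin n → Fin N → ℂ, (∀ l, ζ l ∈ K) ∧
      ∏ j ∈ Finset.range n, t j ≤ ‖monomialDet (fun j : Fin n => a j) ζ‖ := by
  induction n with
  | zero => exact ⟨fun l => l.elim0, fun l => l.elim0, by simp [monomialDet]⟩
  | succ n ih =>
    obtain ⟨ζ, hζ, hle⟩ := ih (fun j hj => ht₀ j (by omega)) fun j hj => ht j (by omega)
    rw [Finset.prod_range_succ]
    by_cases hD : monomialDet (fun j : Fin n => a j) ζ = 0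
    · obtain ⟨z, hz⟩ := hne
      refine ⟨fun _ => z, fun _ => hz, ?_⟩
      rw [hD, norm_zero] at hle
      have := ht₀ n (by omega)
      exact (mul_nonpos_of_nonpos_of_nonneg hle this).trans (norm_nonneg _)
    · have hcont : Continuous fun η : Fin N → ℂ => ‖monomialDet (fun j : Fin (n + 1) => a j)
          (Fin.snoc ζ η : Fin (n + 1) → Fin N → ℂ)‖ := by
        obtain ⟨c, -, hexp⟩ := exists_monomialDet_snoc a ζ
        simp only [hexp]
        exact (continuous_finsetSum _ fun i _ =>
          continuous_const.mul (continuous_evalMonomial (a i))).norm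
      obtain ⟨η, hη, hmax⟩ := hK.exists_isMaxOn hne hcont.continuousOn
      refine ⟨Fin.snoc ζ η, fun l => ?_, ?_⟩
      · refine Fin.lastCases ?_ (fun i => ?_) l
        · simpa using hη
        · simpa using hζ i
      · have h1 := ht n (by omega) _ (hasMonicBound_of_snoc hD fun z hz => hmax hz)
        have hpos := norm_pos_iff.2 hD
        rw [le_div_iff₀ hpos] at h1
        calc _ ≤ ‖monomialDet (fun j : Fin n => a j) ζ‖ * t n :=
              mul_le_mul_of_nonneg_right hle (ht₀ n (by omega))
          _ ≤ _ := by rw [mul_comm]; exact h1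

/-- The determinant of a greedy sequence is a product of bounds on `K` for monic
polynomials.  Once such a determinant vanishes, some monic polynomial vanishes on `K`,
so all later ones vanish too. -/
theorem exists_prod_eq_norm_monomialDet {a : ℕ → Fin N →₀ ℕ} {K : Set (Fin N → ℂ)}
    (hK : IsCompact K) {ζ : ℕ → Fin N → ℂ} (hζ : ∀ j, ζ j ∈ K)
    (hgreedy : ∀ s : ℕ, ∀ η ∈ K,
      ‖monomialDet (fun j : Fin (s + 1) => a j)
        (Fin.snoc (fun i : Fin s => ζ i) η : Fin (s + 1) → Fin N → ℂ)‖ ≤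
          ‖monomialDet (fun j : Fin (s + 1) => a j) (fun i : Fin (s + 1) => ζ i)‖) (n : ℕ) :
    ∃ b : ℕ → ℝ, (∀ j < n, HasMonicBound a K j (b j)) ∧ ∏ j ∈ Finset.range n, b j =
      ‖monomialDet (fun j : Fin n => a j) (fun i : Fin n => ζ i)‖ := by
  induction n with
  | zero => exact ⟨fun _ => 0, by simp, by simp [monomialDet]⟩
  | succ n ih =>
    obtain ⟨b, hb, hprod⟩ := ih
    have key : ∀ x, HasMonicBound a K n x →
        (∀ j < n + 1, HasMonicBound a K j (Function.update b n x j)) ∧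
        ∏ j ∈ Finset.range (n + 1), Function.update b n x j =
          ‖monomialDet (fun j : Fin n => a j) (fun i : Fin n => ζ i)‖ * x := by
      intro x hx
      constructor
      · intro j hj
        rcases Nat.lt_succ_iff_lt_or_eq.1 hj with h | rfl
        · rw [Function.update_of_ne h.ne]
          exact hb j h
        · rwa [Function.update_self]
      · rw [Finset.prod_range_succ, Function.update_self, ← hprod]
        congr 1
        exact Finset.prod_congr rfl fun j hj =>
          Function.update_of_ne (Finset.mem_range.1 hj).ne _ _
    by_cases hD : monomialDet (fun j : Fin n => a j) (fun i : Fin n => ζ i) = 0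
    · obtain ⟨R, hR⟩ := hK.isBounded.exists_norm_le
      obtain ⟨h1, h2⟩ := key _ (hasMonicBound_of_norm_le hR n)
      refine ⟨_, h1, ?_⟩
      have h3 := norm_monomialDet_le h1 (fun i : Fin (n + 1) => ζ i) fun i => hζ i
      rw [hD, norm_zero, zero_mul] at h2
      rw [h2] at h3 ⊢
      exact le_antisymm (norm_nonneg _) (by simpa using h3)
    · obtain ⟨h1, h2⟩ := key _ (hasMonicBound_of_snoc hD (hgreedy n))
      exact ⟨_, h1, by rw [h2, mul_div_cancel₀ _ (norm_ne_zero_iff.2 hD)]⟩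

/-! ### Comparison of the maximal determinant with Leja determinants -/

theorem exists_equiv_latticePoints {C : ConvexBody (Fin N → ℝ)} {k : ℕ} {a : ℕ → Fin N →₀ ℕ}
    (hmem : ∀ j < M C k, a j ∈ latticePoints C k)
    (hinj : ∀ i < M C k, ∀ j < M C k, a i = a j → i = j) :
    ∃ e : Fin (M C k) ≃ latticePoints C k, ∀ j, (e j : Fin N →₀ ℕ) = a j := by
  let f : Fin (M C k) → latticePoints C k := fun j => ⟨a j, hmem j j.2⟩
  have hf : Function.Bijective f := by
    rw [Fintype.bijective_iff_injective_and_card]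
    refine ⟨fun i j hij => Fin.ext (hinj i i.2 j j.2 (congrArg Subtype.val hij)), ?_⟩
    rw [Fintype.card_fin, Fintype.card_coe, M]
  exact ⟨Equiv.ofBijective f hf, fun _ => rfl⟩

section Compact

variable {C : ConvexBody (Fin N → ℝ)} {K : Set (Fin N → ℂ)} {k : ℕ} {a : ℕ → Fin N →₀ ℕ}

/-- The determinant appearing in `maxVdm`, for any enumeration of the lattice points. -/
theorem vdm_latticePoints (e : Fin (M C k) ≃ latticePoints C k)
    (he : ∀ j, (e j : Fin N →₀ ℕ) = a j) (ζ : latticePoints C k → Fin N → ℂ) :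
    vdm (fun _ => 1) k (fun j : latticePoints C k => (j : Fin N →₀ ℕ)) ζ =
      monomialDet (fun j : Fin (M C k) => a j) (ζ ∘ e) := by
  rw [vdm_one, ← monomialDet_comp_equiv e]
  congr 1
  funext j
  exact he j

theorem maxVdm_le (hne : K.Nonempty) (e : Fin (M C k) ≃ latticePoints C k)
    (he : ∀ j, (e j : Fin N →₀ ℕ) = a j) {B : ℝ}
    (hB : ∀ ζ : Fin (M C k) → Fin N → ℂ, (∀ l, ζ l ∈ K) →
      ‖monomialDet (fun j : Fin (M C k) => a j) ζ‖ ≤ B) :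
    maxVdm C (fun _ => 1) K k ≤ B := by
  obtain ⟨z, hz⟩ := hne
  refine csSup_le ⟨_, fun _ => z, fun _ => hz, rfl⟩ ?_
  rintro _ ⟨ζ, hζ, rfl⟩
  rw [vdm_latticePoints e he]
  exact hB _ fun l => hζ (e l)

theorem norm_monomialDet_le_maxVdm (hK : IsCompact K) (e : Fin (M C k) ≃ latticePoints C k)
    (he : ∀ j, (e j : Fin N →₀ ℕ) = a j) (ζ : Fin (M C k) → Fin N → ℂ) (hζ : ∀ l, ζ l ∈ K) :
    ‖monomialDet (fun j : Fin (M C k) => a j) ζ‖ ≤ maxVdm C (fun _ => 1) K k := by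
  obtain ⟨R, hR⟩ := hK.isBounded.exists_norm_le
  refine le_csSup ⟨(M C k).factorial * ∏ j ∈ Finset.range (M C k), R ^ ∑ i, a j i, ?_⟩
    ⟨ζ ∘ e.symm, fun l => hζ _, ?_⟩
  · rintro _ ⟨ξ, hξ, rfl⟩
    rw [vdm_latticePoints e he]
    exact norm_monomialDet_le (fun j _ => hasMonicBound_of_norm_le hR j) _ fun l => hξ (e l)
  · rw [vdm_latticePoints e he, Function.comp_assoc, e.symm_comp_self,
      Function.comp_id]

theorem IsLeja.greedy_monomialDet {ζ : ℕ → Fin N → ℂ}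
    (hC : unitSimplex N ⊆ (C : Set (Fin N → ℝ))) (ha : IsEnumeration C a)
    (hζ : IsLeja C (fun _ => 1) a K ζ) (s : ℕ) (η : Fin N → ℂ) (hη : η ∈ K) :
    ‖monomialDet (fun j : Fin (s + 1) => a j)
      (Fin.snoc (fun i : Fin s => ζ i) η : Fin (s + 1) → Fin N → ℂ)‖ ≤
        ‖monomialDet (fun j : Fin (s + 1) => a j) (fun i : Fin (s + 1) => ζ i)‖ := by
  rcases Nat.eq_zero_or_pos s with rfl | hs
  -- With a single point the determinant is the constant monomial, as `a 0 = 0`.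
  · have h : ∀ ξ : Fin (0 + 1) → Fin N → ℂ,
        monomialDet (fun j : Fin (0 + 1) => a j) ξ = 1 := fun ξ => by
      simp [monomialDet, evalMonomial, ha.zero hC]
    rw [h, h]
  · have h := hζ.greedy s hs η hη
    simpa only [seqVdm, vdm_one] using h

/-- Up to the factor `M_k!`, greedy points realize the maximal determinant. -/
theorem IsLeja.bounds {ζ : ℕ → Fin N → ℂ} (hC : unitSimplex N ⊆ (C : Set (Fin N → ℝ)))
    (hK : IsCompact K) (ha : IsEnumeration C a) (hζ : IsLeja C (fun _ => 1) a K ζ) (k : ℕ) :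
    ‖seqVdm C (fun _ => 1) a (fun i : Fin (M C k) => ζ i)‖ ≤ maxVdm C (fun _ => 1) K k ∧
      maxVdm C (fun _ => 1) K k ≤ (M C k).factorial *
        ‖seqVdm C (fun _ => 1) a (fun i : Fin (M C k) => ζ i)‖ := by
  obtain ⟨e, he⟩ := exists_equiv_latticePoints (C := C) (k := k) (a := a)
    (fun j hj => (ha.mem_latticePoints_iff hC k j).2 hj) fun i _ j _ h => ha.bijective.1 h
  rw [seqVdm, vdm_one]
  refine ⟨norm_monomialDet_le_maxVdm hK e he _ fun l => hζ.mem l,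
    maxVdm_le ⟨_, hζ.mem 0⟩ e he fun ξ hξ => ?_⟩
  obtain ⟨b, hb, hprod⟩ := exists_prod_eq_norm_monomialDet hK hζ.mem
    (hζ.greedy_monomialDet hC ha) (M C k)
  rw [← hprod]
  exact norm_monomialDet_le hb ξ hξ

/-! ### Chebyshev constants for the lexicographic order -/

/-- The bounds on `K` for polynomials in `Poly(kC)` that are monic of lexicographic degree `α`. -/
def chebyshevBounds (C : ConvexBody (Fin N → ℝ)) (K : Set (Fin N → ℂ)) (k : ℕ)
    (α : Fin N →₀ ℕ) : Set ℝ :=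
  {b | 0 ≤ b ∧ ∃ p ∈ Poly C k, MonomialOrder.lex.degree p = α ∧ MonomialOrder.lex.Monic p ∧
    ∀ z ∈ K, ‖MvPolynomial.eval z p‖ ≤ b}

/-- The Chebyshev constant of `α ∈ kC`: the least sup norm on `K` of a polynomial in `Poly(kC)`
with leading term `z^α` for the lexicographic order.  Unlike `≺_C`, this order is compatible with
multiplication. -/
def chebyshevConst (C : ConvexBody (Fin N → ℝ)) (K : Set (Fin N → ℂ)) (k : ℕ)
    (α : Fin N →₀ ℕ) : ℝ := sInf (chebyshevBounds C K k α)

theorem chebyshevConst_nonneg (α : Fin N →₀ ℕ) : 0 ≤ chebyshevConst C K k α :=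
  Real.sInf_nonneg fun _ hb => hb.1

theorem chebyshevConst_le {α : Fin N →₀ ℕ} {b : ℝ} (hb : b ∈ chebyshevBounds C K k α) :
    chebyshevConst C K k α ≤ b := csInf_le ⟨0, fun _ hx => hx.1⟩ hb

theorem pow_mem_chebyshevBounds {R : ℝ} (hR₀ : 0 ≤ R) (hR : ∀ z ∈ K, ‖z‖ ≤ R) {α : Fin N →₀ ℕ}
    (hα : α ∈ latticePoints C k) : R ^ (∑ i, α i) ∈ chebyshevBounds C K k α := by
  refine ⟨by positivity, MvPolynomial.monomial α 1, ?_, ?_, MonomialOrder.monic_monomial_one,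
    fun z hz => ?_⟩
  · intro β hβ
    rw [MvPolynomial.support_monomial, if_neg one_ne_zero, Finset.mem_singleton] at hβ
    rwa [hβ]
  · simp [MonomialOrder.degree_monomial]
  · rw [MvPolynomial.eval_monomial, one_mul, Finsupp.prod_fintype _ _ (by simp)]
    exact norm_evalMonomial_le α (hR z hz)

theorem mul_mem_chebyshevBounds {l : ℕ} {α β : Fin N →₀ ℕ} {b c : ℝ}
    (hb : b ∈ chebyshevBounds C K k α) (hc : c ∈ chebyshevBounds C K l β) :
    b * c ∈ chebyshevBounds C K (k + l) (α + β) := by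
  classical
  obtain ⟨hb₀, p, hp, hpα, hpm, hpb⟩ := hb
  obtain ⟨hc₀, q, hq, hqβ, hqm, hqc⟩ := hc
  refine ⟨mul_nonneg hb₀ hc₀, p * q, ?_, ?_, hpm.mul hqm, fun z hz => ?_⟩
  · intro γ hγ
    obtain ⟨β₁, h1, β₂, h2, rfl⟩ := Finset.mem_add.1 (MvPolynomial.support_mul p q hγ)
    exact add_mem_latticePoints (hp _ h1) (hq _ h2)
  · rw [MonomialOrder.degree_mul hpm.ne_zero hqm.ne_zero, hpα, hqβ]
  · rw [map_mul, norm_mul]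
    exact mul_le_mul (hpb z hz) (hqc z hz) (norm_nonneg _) hb₀

theorem chebyshevBounds_nonempty (hK : IsCompact K) {α : Fin N →₀ ℕ}
    (hα : α ∈ latticePoints C k) : (chebyshevBounds C K k α).Nonempty := by
  obtain ⟨R, hR₀, hR⟩ := hK.isBounded.exists_pos_norm_le
  exact ⟨_, pow_mem_chebyshevBounds hR₀.le hR hα⟩

theorem chebyshevConst_add_le (hK : IsCompact K) {l : ℕ} {α β : Fin N →₀ ℕ}
    (hα : α ∈ latticePoints C k) (hβ : β ∈ latticePoints C l) :
    chebyshevConst C K (k + l) (α + β) ≤ chebyshevConst C K k α * chebyshevConst C K l β := by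
  have h1 : ∀ b ∈ chebyshevBounds C K k α, ∀ c ∈ chebyshevBounds C K l β,
      chebyshevConst C K (k + l) (α + β) ≤ b * c := fun b hb c hc =>
    chebyshevConst_le (mul_mem_chebyshevBounds hb hc)
  have hlim : Tendsto (fun ε : ℝ => (chebyshevConst C K k α + ε) * (chebyshevConst C K l β + ε))
      (𝓝[>] 0) (𝓝 (chebyshevConst C K k α * chebyshevConst C K l β)) := by
    have : Continuous fun ε : ℝ =>
        (chebyshevConst C K k α + ε) * (chebyshevConst C K l β + ε) := by fun_prop
    simpa using (this.tendsto 0).mono_left nhdsWithin_le_nhds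
  refine ge_of_tendsto hlim ?_
  filter_upwards [self_mem_nhdsWithin] with ε hε
  have hε' : 0 < ε := hε
  obtain ⟨b, hb, hbε⟩ := exists_lt_of_csInf_lt (chebyshevBounds_nonempty hK hα)
    (show sInf _ < chebyshevConst C K k α + ε from lt_add_of_pos_right _ hε')
  obtain ⟨c, hc, hcε⟩ := exists_lt_of_csInf_lt (chebyshevBounds_nonempty hK hβ)
    (show sInf _ < chebyshevConst C K l β + ε from lt_add_of_pos_right _ hε')
  exact (h1 b hb c hc).trans (mul_le_mul hbε.le hcε.le hc.1 (hb.1.trans hbε.le))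

/-- The lattice points of `kC` in increasing lexicographic order. -/
theorem exists_lex_enumeration (C : ConvexBody (Fin N → ℝ)) (k : ℕ) :
    ∃ a : ℕ → Fin N →₀ ℕ, (∀ j < M C k, a j ∈ latticePoints C k) ∧
      (∀ α ∈ latticePoints C k, ∃ j < M C k, a j = α) ∧
      ∀ i j, i < j → j < M C k →
        MonomialOrder.lex.toSyn (a i) < MonomialOrder.lex.toSyn (a j) := by
  let s := (latticePoints C k).map (MonomialOrder.lex (σ := Fin N)).toSyn.toEquiv.toEmbedding
  have hs : s.card = M C k := Finset.card_map _
  let f := s.orderIsoOfFin hs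
  refine ⟨fun j => if h : j < M C k then MonomialOrder.lex.toSyn.symm (f ⟨j, h⟩) else 0,
    fun j hj => ?_, fun α hα => ?_, fun i j hij hj => ?_⟩
  · simp only [dif_pos hj]
    have h1 := (f ⟨j, hj⟩).2
    obtain ⟨α, hα, h2⟩ := Finset.mem_map.1 h1
    rw [← h2]
    simpa using hα
  · have h1 : MonomialOrder.lex.toSyn α ∈ s := Finset.mem_map.2 ⟨α, hα, rfl⟩
    refine ⟨f.symm ⟨_, h1⟩, (f.symm ⟨_, h1⟩).2, ?_⟩
    simp
  · simp only [dif_pos hj, dif_pos (hij.trans hj), AddEquiv.apply_symm_apply]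
    exact f.strictMono (show (⟨i, hij.trans hj⟩ : Fin _) < ⟨j, hj⟩ from hij)

theorem mem_chebyshevBounds_iff {a : ℕ → Fin N →₀ ℕ}
    (hmem : ∀ j < M C k, a j ∈ latticePoints C k)
    (hsurj : ∀ α ∈ latticePoints C k, ∃ j < M C k, a j = α)
    (hmono : ∀ i j, i < j → j < M C k →
        MonomialOrder.lex.toSyn (a i) < MonomialOrder.lex.toSyn (a j))
    {j : ℕ} (hj : j < M C k) {b : ℝ} :
    b ∈ chebyshevBounds C K k (a j) ↔ 0 ≤ b ∧ HasMonicBound a K j b := by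
  have hinj : Set.InjOn a (Finset.range (j + 1)) := by
    intro i hi i' hi' h
    simp only [Finset.coe_range, Set.mem_Iio] at hi hi'
    by_contra hne
    rcases lt_or_gt_of_ne hne with hlt | hlt
    · exact (hmono i i' hlt (by omega)).ne (by rw [h])
    · exact (hmono i' i hlt (by omega)).ne (by rw [h])
  constructor
  · rintro ⟨hb, p, hp, hpα, hpm, hpb⟩
    refine ⟨hb, fun i => p.coeff (a i), ?_, fun z hz => ?_⟩
    · beta_reduce
      rw [← hpα]
      exact hpm
    · refine le_of_eq_of_le (congrArg _ ?_) (hpb z hz)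
      rw [MvPolynomial.eval_eq', ← Finset.sum_image (s := Finset.range (j + 1)) (g := a)
        (f := fun β => p.coeff β * evalMonomial β z) hinj]
      symm
      refine Finset.sum_subset (fun β hβ => ?_) fun β _ hβ => ?_
      · obtain ⟨i, hi, rfl⟩ := hsurj β (hp β hβ)
        have h1 := MonomialOrder.lex.le_degree hβ
        rw [hpα] at h1
        refine Finset.mem_image.2 ⟨i, ?_, rfl⟩
        rw [Finset.mem_range, Nat.lt_succ_iff]
        by_contra hlt
        exact absurd (hmono j i (by omega) hi) (not_lt.2 h1)
      · rw [MvPolynomial.notMem_support_iff.1 hβ, zero_mul]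
  · rintro ⟨hb, c, hc, hcb⟩
    let p : MvPolynomial (Fin N) ℂ :=
      ∑ i ∈ Finset.range (j + 1), MvPolynomial.monomial (a i) (c i)
    have hsupp : ∀ β ∈ p.support, ∃ i < j + 1, a i = β := by
      intro β hβ
      by_contra hno
      push Not at hno
      refine MvPolynomial.mem_support_iff.1 hβ ?_
      rw [MvPolynomial.coeff_sum]
      refine Finset.sum_eq_zero fun i hi => ?_
      rw [MvPolynomial.coeff_monomial, if_neg (hno i (Finset.mem_range.1 hi))]
    have hcoeff : p.coeff (a j) = 1 := by
      rw [MvPolynomial.coeff_sum, Finset.sum_eq_single j]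
      · simp [hc]
      · intro i hi hij
        rw [MvPolynomial.coeff_monomial, if_neg fun h => hij (hinj (by simpa using hi) (by simp) h)]
      · simp
    have hdeg : MonomialOrder.lex.degree p = a j := by
      apply MonomialOrder.lex.toSyn.injective
      refine le_antisymm (MonomialOrder.lex.degree_le_iff.2 fun β hβ => ?_)
        (MonomialOrder.lex.le_degree (MvPolynomial.mem_support_iff.2 (by simp [hcoeff])))
      obtain ⟨i, hi, rfl⟩ := hsupp β hβ
      rcases (Nat.lt_succ_iff.1 hi).eq_or_lt with rfl | hlt
      · exact le_rfl
      · exact (hmono i j hlt hj).le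
    refine ⟨hb, p, fun β hβ => ?_, hdeg, ?_, fun z hz => ?_⟩
    · obtain ⟨i, hi, rfl⟩ := hsupp β hβ
      exact hmem i (by omega)
    · rw [MonomialOrder.Monic, MonomialOrder.leadingCoeff, hdeg, hcoeff]
    · refine le_of_eq_of_le (congrArg _ ?_) (hcb z hz)
      rw [map_sum]
      refine Finset.sum_congr rfl fun i _ => ?_
      rw [MvPolynomial.eval_monomial, Finsupp.prod_fintype _ _ (by simp)]
      rfl

/-- The maximal determinant is the product of the Chebyshev constants, up to `M_k!`. -/
theorem maxVdm_bounds (hK : IsCompact K) (hne : K.Nonempty) (k : ℕ) :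
    ∏ α ∈ latticePoints C k, chebyshevConst C K k α ≤ maxVdm C (fun _ => 1) K k ∧
      maxVdm C (fun _ => 1) K k ≤
        (M C k).factorial * ∏ α ∈ latticePoints C k, chebyshevConst C K k α := by
  obtain ⟨a, hmem, hsurj, hmono⟩ := exists_lex_enumeration C k
  have hinj : ∀ i < M C k, ∀ j < M C k, a i = a j → i = j := by
    intro i hi j hj h
    by_contra hne
    rcases lt_or_gt_of_ne hne with hlt | hlt
    · exact (hmono i j hlt hj).ne (by rw [h])
    · exact (hmono j i hlt hi).ne (by rw [h])
  obtain ⟨e, he⟩ := exists_equiv_latticePoints hmem hinj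
  have hprod : ∀ f : (Fin N →₀ ℕ) → ℝ,
      ∏ α ∈ latticePoints C k, f α = ∏ j ∈ Finset.range (M C k), f (a j) := by
    intro f
    rw [← Finset.prod_coe_sort, ← Fin.prod_univ_eq_prod_range (fun j => f (a j)),
      ← Equiv.prod_comp e]
    exact Finset.prod_congr rfl fun j _ => by rw [he]
  rw [hprod]
  constructor
  · obtain ⟨ζ, hζ, hle⟩ := exists_prod_le_norm_monomialDet (a := a)
      (t := fun j => chebyshevConst C K k (a j)) hK hne (M C k)
      (fun j _ => chebyshevConst_nonneg _) fun j hj b hb => by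
        obtain ⟨z, hz⟩ := hne
        refine chebyshevConst_le ((mem_chebyshevBounds_iff hmem hsurj hmono hj).2 ⟨?_, hb⟩)
        obtain ⟨c, -, hc⟩ := hb
        exact (norm_nonneg _).trans (hc z hz)
    exact hle.trans (norm_monomialDet_le_maxVdm hK e he ζ hζ)
  · refine maxVdm_le hne e he fun ζ hζ => ?_
    have hlim : Tendsto (fun ε : ℝ => ((M C k).factorial : ℝ) *
        ∏ j ∈ Finset.range (M C k), (chebyshevConst C K k (a j) + ε)) (𝓝[>] 0)
        (𝓝 ((M C k).factorial * ∏ j ∈ Finset.range (M C k), chebyshevConst C K k (a j))) := by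
      have : Continuous fun ε : ℝ => ((M C k).factorial : ℝ) *
          ∏ j ∈ Finset.range (M C k), (chebyshevConst C K k (a j) + ε) := by fun_prop
      simpa using (this.tendsto 0).mono_left nhdsWithin_le_nhds
    refine ge_of_tendsto hlim ?_
    filter_upwards [self_mem_nhdsWithin] with ε hε
    refine norm_monomialDet_le (fun j hj => ?_) ζ hζ
    obtain ⟨b, hb, hbε⟩ := exists_lt_of_csInf_lt (chebyshevBounds_nonempty hK (hmem j hj))
      (show sInf _ < chebyshevConst C K k (a j) + ε from lt_add_of_pos_right _ hε)
    obtain ⟨c, hc, hcb⟩ := ((mem_chebyshevBounds_iff hmem hsurj hmono hj).1 hb).2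
    exact ⟨c, hc, fun z hz => (hcb z hz).trans hbε.le⟩

end Compact

section Asymptotics

variable {C : ConvexBody (Fin N → ℝ)} {K : Set (Fin N → ℂ)}

/-! ### Growth of `L_k` and of `M_k!` -/

theorem exists_tendsto_L_div_pow (hN : 1 ≤ N) (hC₀ : ∀ x ∈ C, ∀ i, 0 ≤ x i)
    (hC : unitSimplex N ⊆ (C : Set (Fin N → ℝ))) :
    ∃ ℓ : ℝ, 0 < ℓ ∧ Tendsto (fun k : ℕ => (L C k : ℝ) / (k : ℝ) ^ (N + 1)) atTop (𝓝 ℓ) := by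
  obtain ⟨A, hA, hAC⟩ := exists_degree_bound C
  obtain ⟨ℓ, hℓ⟩ := exists_tendsto_sum_div_pow hC₀ hC
    (G := fun _ α => -((∑ i, α i : ℕ) : ℝ)) (fun k α _ => by simp only [neg_nonpos]; positivity)
    (fun k l α _ β _ => by rw [sum_add]; push_cast; linarith) A hA
    (fun k α hα => neg_le_neg (hAC k α hα))
  have hlim : Tendsto (fun k : ℕ => (L C k : ℝ) / (k : ℝ) ^ (N + 1)) atTop (𝓝 (-ℓ)) := by
    refine hℓ.neg.congr fun k => ?_
    rw [Finset.sum_neg_distrib, neg_div, neg_neg, L]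
    push_cast
    rfl
  obtain ⟨c, hc, hcM⟩ := exists_le_M_half hC₀ hC
  refine ⟨-ℓ, lt_of_lt_of_le (half_pos hc) (ge_of_tendsto hlim ?_), hlim⟩
  filter_upwards [hcM, eventually_gt_atTop 0] with k hk hk0
  have hk' : (0 : ℝ) < k := by exact_mod_cast hk0
  -- Translating `(k/2)C` by a multiple of a coordinate vector gives points of large degree.
  let u : Fin N →₀ ℕ := Finsupp.single ⟨0, hN⟩ (k - k / 2)
  have hu : ∑ i, u i = k - k / 2 := by
    rw [Finset.sum_eq_single_of_mem (⟨0, hN⟩ : Fin N) (Finset.mem_univ _) fun i _ hi =>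
      Finsupp.single_eq_of_ne hi]
    exact Finsupp.single_eq_same
  have h1 : M C (k / 2) * (k - k / 2) ≤ L C k := by
    calc M C (k / 2) * (k - k / 2) = ∑ _α ∈ latticePoints C (k / 2), (k - k / 2) := by
          rw [Finset.sum_const, smul_eq_mul, M]
      _ ≤ ∑ α ∈ latticePoints C (k / 2), ∑ i, (α + u) i :=
          Finset.sum_le_sum fun α _ => by rw [sum_add, hu]; omega
      _ = ∑ β ∈ (latticePoints C (k / 2)).map (addRightEmbedding u), ∑ i, β i := by
          rw [Finset.sum_map]
          rfl
      _ ≤ L C k := by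
          refine Finset.sum_le_sum_of_subset fun β hβ => ?_
          obtain ⟨α, hα, rfl⟩ := Finset.mem_map.1 hβ
          have h2 := add_mem_latticePoints hα (mem_latticePoints_of_sum_le hC hu.le)
          rwa [Nat.add_sub_cancel' (Nat.div_le_self k 2)] at h2
  have h2 : (k : ℝ) / 2 ≤ ((k - k / 2 : ℕ) : ℝ) := by
    have : k ≤ 2 * (k - k / 2) := by omega
    have : (k : ℝ) ≤ 2 * ((k - k / 2 : ℕ) : ℝ) := by exact_mod_cast this
    linarith
  rw [le_div_iff₀ (by positivity)]
  calc c / 2 * (k : ℝ) ^ (N + 1) = (c * (k : ℝ) ^ N) * (k / 2) := by ring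
    _ ≤ M C (k / 2) * ((k - k / 2 : ℕ) : ℝ) := by gcongr
    _ ≤ L C k := by exact_mod_cast h1

theorem L_pos (hN : 1 ≤ N) (hC : unitSimplex N ⊆ (C : Set (Fin N → ℝ))) {k : ℕ} (hk : 0 < k) :
    0 < L C k := by
  refine Finset.sum_pos' (fun _ _ => Nat.zero_le _)
    ⟨Finsupp.single ⟨0, hN⟩ k, mem_latticePoints_of_sum_le hC ?_, ?_⟩ <;>
  simp [Finsupp.single_apply, hk]

theorem tendsto_log_factorial_M_div_L (hN : 1 ≤ N) (hC₀ : ∀ x ∈ C, ∀ i, 0 ≤ x i)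
    (hC : unitSimplex N ⊆ (C : Set (Fin N → ℝ))) :
    Tendsto (fun k : ℕ => Real.log ((M C k).factorial : ℝ) / L C k) atTop (𝓝 0) := by
  obtain ⟨c, hc, hcM⟩ := exists_M_le hC₀ (C := C)
  obtain ⟨ℓ, hℓ, hL⟩ := exists_tendsto_L_div_pow hN hC₀ hC
  have h1 : Tendsto (fun k : ℕ => c * (Real.log c / k + N * (Real.log k / k))) atTop (𝓝 0) := by
    have h2 : Tendsto (fun k : ℕ => Real.log k / (k : ℝ)) atTop (𝓝 0) :=
      (Real.isLittleO_log_id_atTop.tendsto_div_nhds_zero).comp tendsto_natCast_atTop_atTop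
    have h3 := ((tendsto_const_div_atTop_nhds_zero_nat (Real.log c)).add
      (h2.const_mul (N : ℝ))).const_mul c
    simpa using h3
  have h4 : Tendsto (fun k : ℕ => Real.log ((M C k).factorial : ℝ) / (k : ℝ) ^ (N + 1))
      atTop (𝓝 0) := by
    refine squeeze_zero' (Eventually.of_forall fun k => div_nonneg (Real.log_nonneg ?_)
      (by positivity)) ?_ h1
    · exact_mod_cast Nat.factorial_pos (M C k)
    filter_upwards [eventually_gt_atTop 0] with k hk
    have hk' : (0 : ℝ) < k := by exact_mod_cast hk
    have hM1 : (1 : ℝ) ≤ M C k := by exact_mod_cast M_pos hC k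
    have h5 : Real.log ((M C k).factorial : ℝ) ≤ M C k * Real.log (M C k) := by
      rw [← Real.log_pow]
      refine Real.log_le_log (by exact_mod_cast Nat.factorial_pos _) ?_
      exact_mod_cast Nat.factorial_le_pow (M C k)
    have h6 : Real.log (M C k) ≤ Real.log c + N * Real.log k := by
      rw [← Real.log_pow, ← Real.log_mul hc.ne' (by positivity)]
      exact Real.log_le_log (by linarith) (hcM k hk)
    have h7 : (M C k : ℝ) * Real.log (M C k) ≤
        c * (k : ℝ) ^ N * (Real.log c + N * Real.log k) :=
      mul_le_mul (hcM k hk) h6 (Real.log_nonneg hM1) (by positivity)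
    rw [div_le_iff₀ (by positivity)]
    refine (h5.trans h7).trans (le_of_eq ?_)
    rw [pow_succ]
    field_simp
  have h8 := h4.div hL hℓ.ne'
  rw [zero_div] at h8
  refine h8.congr' ?_
  filter_upwards [eventually_gt_atTop 0] with k hk
  have hk' : (k : ℝ) ^ (N + 1) ≠ 0 := pow_ne_zero _ (by exact_mod_cast hk.ne')
  simp only [Pi.div_apply]
  exact div_div_div_cancel_right₀ hk' _ _

theorem tendsto_factorial_M_rpow (hN : 1 ≤ N) (hC₀ : ∀ x ∈ C, ∀ i, 0 ≤ x i)
    (hC : unitSimplex N ⊆ (C : Set (Fin N → ℝ))) :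
    Tendsto (fun k : ℕ => ((M C k).factorial : ℝ) ^ (1 / (L C k : ℝ))) atTop (𝓝 1) := by
  have h := (Real.continuous_exp.tendsto 0).comp (tendsto_log_factorial_M_div_L hN hC₀ hC)
  rw [Real.exp_zero] at h
  refine h.congr fun k => ?_
  have : (0 : ℝ) < (M C k).factorial := by exact_mod_cast Nat.factorial_pos _
  rw [Function.comp, Real.rpow_def_of_pos this, mul_one_div]

/-! ### Convergence of the product of the Chebyshev constants -/

/-- A single very negative value of a subadditive function forces very negative averages: the
points `jα + δ` with `jk ≈ n / 2` and `δ ∈ (n - jk)C` are a positive proportion of `nC`. -/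
theorem sum_le_of_apply_le {G : ℕ → (Fin N →₀ ℕ) → ℝ}
    (hC : unitSimplex N ⊆ (C : Set (Fin N → ℝ)))
    (hG₀ : ∀ k, ∀ α ∈ latticePoints C k, G k α ≤ 0)
    (hadd : ∀ k l, ∀ α ∈ latticePoints C k, ∀ β ∈ latticePoints C l,
      G (k + l) (α + β) ≤ G k α + G l β)
    {c A : ℝ} (hA : 0 ≤ A) {k : ℕ} (hk : 0 < k) {α : Fin N →₀ ℕ}
    (hα : α ∈ latticePoints C k) (hGα : G k α ≤ -(A * k)) {n : ℕ} (hn : 4 * k ≤ n)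
    (hM : c * (n : ℝ) ^ N ≤ M C (n / 2)) :
    (∑ β ∈ latticePoints C n, G n β) / (n : ℝ) ^ (N + 1) ≤ -(A * c / 4) := by
  classical
  have hn' : (0 : ℝ) < n := by
    have : 0 < n := by omega
    exact_mod_cast this
  set j := n / (2 * k)
  have hj1 : 2 * (j * k) ≤ n := by
    have := Nat.div_mul_le_self n (2 * k)
    calc 2 * (j * k) = j * (2 * k) := by ring
      _ ≤ n := this
  have hj2 : n ≤ 4 * (j * k) := by
    have h1 : n < j * (2 * k) + 2 * k := Nat.lt_div_mul_add (by omega)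
    have h2 : j * (2 * k) = 2 * (j * k) := by ring
    omega
  set γ := ∑ _i ∈ Finset.range j, α
  obtain ⟨hγ, hGγ⟩ := apply_sum_le hC hG₀ hadd k (fun _ => α) j fun _ _ => hα
  have hle : j * k ≤ n := by omega
  have hmem : ∀ δ ∈ latticePoints C (n - j * k), γ + δ ∈ latticePoints C n := fun δ hδ => by
    have := add_mem_latticePoints hγ hδ
    rwa [Nat.add_sub_cancel' hle] at this
  have hGδ : ∀ δ ∈ latticePoints C (n - j * k), G n (γ + δ) ≤ -(A * (n / 4)) := fun δ hδ => by
    have h1 := hadd _ _ _ hγ δ hδ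
    rw [Nat.add_sub_cancel' hle] at h1
    have h2 := hG₀ _ δ hδ
    have hsum : ∑ _i ∈ Finset.range j, G k α = j * G k α := by simp
    rw [hsum] at hGγ
    have h3 : (j : ℝ) * G k α ≤ j * -(A * k) := by gcongr
    have h4 : (n : ℝ) / 4 ≤ j * k := by
      have : (n : ℝ) ≤ 4 * (j * k) := by exact_mod_cast hj2
      linarith
    have h5 : A * (n / 4) ≤ A * (j * k) := by gcongr
    linarith
  have hsub : (latticePoints C (n - j * k)).map (addLeftEmbedding γ) ⊆ latticePoints C n := by
    intro β hβ
    obtain ⟨δ, hδ, rfl⟩ := Finset.mem_map.1 hβ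
    exact hmem δ hδ
  have h1 : ∑ β ∈ latticePoints C n, G n β ≤
      ∑ δ ∈ latticePoints C (n - j * k), G n (γ + δ) := by
    rw [← Finset.sum_sdiff hsub, Finset.sum_map]
    have : ∑ β ∈ latticePoints C n \ (latticePoints C (n - j * k)).map (addLeftEmbedding γ),
        G n β ≤ 0 := Finset.sum_nonpos fun β hβ => hG₀ n β (Finset.mem_sdiff.1 hβ).1
    simp only [addLeftEmbedding_apply]
    linarith
  have h2 := Finset.sum_le_sum hGδ
  rw [Finset.sum_const, nsmul_eq_mul] at h2
  have h3 : c * (n : ℝ) ^ N ≤ (latticePoints C (n - j * k)).card := by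
    refine hM.trans ?_
    exact_mod_cast Finset.card_le_card (latticePoints_mono hC (show n / 2 ≤ n - j * k by omega))
  have h4 : c * (n : ℝ) ^ N * (A * (n / 4)) ≤
      (latticePoints C (n - j * k)).card * (A * (n / 4)) := by gcongr
  rw [div_le_iff₀ (by positivity)]
  have h5 : -(A * c / 4) * (n : ℝ) ^ (N + 1) = -(c * (n : ℝ) ^ N * (A * (n / 4))) := by ring
  rw [h5]
  linarith

/-- The normalized logarithmic Chebyshev constant `log (T_k(α) / R^{|α|})`, cut off below at
`-A k`.  The cutoff keeps subadditivity and makes the logarithm finite even where the Chebyshev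
constant vanishes. -/
def truncatedLog (C : ConvexBody (Fin N → ℝ)) (K : Set (Fin N → ℂ)) (R A : ℝ) (k : ℕ)
    (α : Fin N →₀ ℕ) : ℝ :=
  Real.log (max (chebyshevConst C K k α / R ^ ∑ i, α i) (Real.exp (-(A * k))))

theorem truncatedLog_nonpos {R A : ℝ} (hR₁ : 1 ≤ R) (hR : ∀ z ∈ K, ‖z‖ ≤ R) (hA : 0 ≤ A)
    (k : ℕ) (α : Fin N →₀ ℕ) (hα : α ∈ latticePoints C k) : truncatedLog C K R A k α ≤ 0 := by
  have hR₀ : 0 < R := by linarith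
  refine Real.log_nonpos (le_max_of_le_right (Real.exp_pos _).le) (max_le ?_ ?_)
  · rw [div_le_one (by positivity)]
    exact chebyshevConst_le (pow_mem_chebyshevBounds hR₀.le hR hα)
  · rw [Real.exp_le_one_iff]
    have : 0 ≤ A * k := by positivity
    linarith

theorem le_truncatedLog (R A : ℝ) (k : ℕ) (α : Fin N →₀ ℕ) :
    -(A * k) ≤ truncatedLog C K R A k α := by
  rw [truncatedLog, Real.le_log_iff_exp_le (lt_max_of_lt_right (Real.exp_pos _))]
  exact le_max_right _ _

theorem truncatedLog_add_le (hK : IsCompact K) {R A : ℝ} (hR₀ : 0 < R) (k l : ℕ)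
    (α : Fin N →₀ ℕ) (hα : α ∈ latticePoints C k) (β : Fin N →₀ ℕ) (hβ : β ∈ latticePoints C l) :
    truncatedLog C K R A (k + l) (α + β) ≤
      truncatedLog C K R A k α + truncatedLog C K R A l β := by
  have h1 : ∀ (m : ℕ) (γ : Fin N →₀ ℕ),
      0 < max (chebyshevConst C K m γ / R ^ ∑ i, γ i) (Real.exp (-(A * m))) := fun m γ =>
    lt_max_of_lt_right (Real.exp_pos _)
  have h0 : ∀ (m : ℕ) (γ : Fin N →₀ ℕ), 0 ≤ chebyshevConst C K m γ / R ^ ∑ i, γ i := fun m γ =>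
    div_nonneg (chebyshevConst_nonneg γ) (by positivity)
  rw [truncatedLog, truncatedLog, truncatedLog, ← Real.log_mul (h1 _ _).ne' (h1 _ _).ne']
  refine Real.log_le_log (h1 _ _) (max_le ?_ ?_)
  · calc _ ≤ (chebyshevConst C K k α / R ^ ∑ i, α i) * (chebyshevConst C K l β / R ^ ∑ i, β i) := by
          rw [sum_add, pow_add, div_mul_div_comm]
          gcongr
          exact chebyshevConst_add_le hK hα hβ
      _ ≤ _ := mul_le_mul (le_max_left _ _) (le_max_left _ _) (h0 _ _) (h1 _ _).le
  · calc _ = Real.exp (-(A * k)) * Real.exp (-(A * l)) := by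
          rw [← Real.exp_add]
          push_cast
          ring_nf
      _ ≤ _ := mul_le_mul (le_max_right _ _) (le_max_right _ _) (Real.exp_pos _).le (h1 _ _).le

theorem prod_chebyshevConst {R : ℝ} (hR₀ : 0 < R) (k : ℕ) :
    ∏ α ∈ latticePoints C k, chebyshevConst C K k α =
      (∏ α ∈ latticePoints C k, chebyshevConst C K k α / R ^ ∑ i, α i) * R ^ L C k := by
  rw [L, ← Finset.prod_pow_eq_pow_sum, ← Finset.prod_mul_distrib]
  exact Finset.prod_congr rfl fun α _ => (div_mul_cancel₀ _ (by positivity)).symm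

theorem exp_sum_truncatedLog (R A : ℝ) (k : ℕ) :
    Real.exp (∑ α ∈ latticePoints C k, truncatedLog C K R A k α) =
      ∏ α ∈ latticePoints C k,
        max (chebyshevConst C K k α / R ^ ∑ i, α i) (Real.exp (-(A * k))) := by
  rw [Real.exp_sum]
  exact Finset.prod_congr rfl fun α _ => Real.exp_log (lt_max_of_lt_right (Real.exp_pos _))

theorem exp_mul_pow_rpow {R : ℝ} (hR₀ : 0 < R) (S : ℝ) {n : ℕ} (hn : 0 < n) :
    (Real.exp S * R ^ n) ^ (1 / (n : ℝ)) = Real.exp (S / n) * R := by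
  have hn' : (n : ℝ) ≠ 0 := by exact_mod_cast hn.ne'
  rw [Real.mul_rpow (Real.exp_pos _).le (by positivity), ← Real.exp_mul, mul_one_div,
    one_div, Real.pow_rpow_inv_natCast hR₀.le hn.ne']

/-- Either some cutoff is never active, and the limit comes from the subadditive theorem, or all
cutoffs are active somewhere and the limit is `0`. -/
theorem exists_tendsto_prod_chebyshevConst (hN : 1 ≤ N) (hC₀ : ∀ x ∈ C, ∀ i, 0 ≤ x i)
    (hC : unitSimplex N ⊆ (C : Set (Fin N → ℝ))) (hK : IsCompact K) :
    ∃ d : ℝ, Tendsto (fun k : ℕ =>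
      (∏ α ∈ latticePoints C k, chebyshevConst C K k α) ^ (1 / (L C k : ℝ))) atTop (𝓝 d) := by
  obtain ⟨R', hR'⟩ := hK.isBounded.exists_norm_le
  set R := max R' 1
  have hR₁ : 1 ≤ R := le_max_right _ _
  have hR₀ : 0 < R := by linarith
  have hR : ∀ z ∈ K, ‖z‖ ≤ R := fun z hz => (hR' z hz).trans (le_max_left _ _)
  obtain ⟨ℓ, hℓ, hL⟩ := exists_tendsto_L_div_pow hN hC₀ hC
  have hlim : ∀ A, 0 ≤ A → ∃ s : ℝ,
      Tendsto (fun k : ℕ => (∑ α ∈ latticePoints C k, truncatedLog C K R A k α) /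
        (k : ℝ) ^ (N + 1)) atTop (𝓝 s) ∧
      Tendsto (fun k : ℕ => Real.exp ((∑ α ∈ latticePoints C k, truncatedLog C K R A k α) /
        L C k) * R) atTop (𝓝 (Real.exp (s / ℓ) * R)) := by
    intro A hA
    obtain ⟨s, hs⟩ := exists_tendsto_sum_div_pow hC₀ hC (truncatedLog_nonpos (C := C) hR₁ hR hA)
      (truncatedLog_add_le hK hR₀) A hA fun k α _ => le_truncatedLog R A k α
    refine ⟨s, hs, Tendsto.mul_const _ ((Real.continuous_exp.tendsto _).comp ?_)⟩
    refine (hs.div hL hℓ.ne').congr' ?_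
    filter_upwards [eventually_gt_atTop 0] with k hk
    have hk' : (k : ℝ) ^ (N + 1) ≠ 0 := pow_ne_zero _ (by exact_mod_cast hk.ne')
    simp only [Pi.div_apply]
    exact div_div_div_cancel_right₀ hk' _ _
  by_cases hcase : ∃ A : ℝ, 0 ≤ A ∧ ∀ k, 0 < k → ∀ α ∈ latticePoints C k,
      Real.exp (-(A * k)) ≤ chebyshevConst C K k α / R ^ ∑ i, α i
  · obtain ⟨A, hA, hAle⟩ := hcase
    obtain ⟨s, -, hs⟩ := hlim A hA
    refine ⟨_, hs.congr' ?_⟩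
    filter_upwards [eventually_gt_atTop 0] with k hk
    rw [prod_chebyshevConst hR₀, ← exp_mul_pow_rpow hR₀ _ (L_pos hN hC hk), exp_sum_truncatedLog]
    congr 2
    exact Finset.prod_congr rfl fun α hα => max_eq_left (hAle k hk α hα)
  · push Not at hcase
    obtain ⟨c, hc, hcM⟩ := exists_le_M_half hC₀ hC
    refine ⟨0, tendsto_order.2 ⟨fun x hx => Eventually.of_forall fun k => lt_of_lt_of_le hx
      (Real.rpow_nonneg (Finset.prod_nonneg fun α _ => chebyshevConst_nonneg α) _), fun ε hε => ?_⟩⟩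
    -- A cutoff so low that even the truncated products stay below `ε` in the limit.
    obtain ⟨A, hA, hAε⟩ : ∃ A : ℝ, 0 ≤ A ∧ Real.exp (-(A * c / 4) / ℓ) * R < ε := by
      have h1 : Tendsto (fun A : ℝ => Real.exp (-(A * (c / 4 / ℓ))) * R) atTop (𝓝 (0 * R)) :=
        Tendsto.mul_const _ (Real.tendsto_exp_neg_atTop_nhds_zero.comp
          (tendsto_id.atTop_mul_const (by positivity)))
      rw [zero_mul] at h1
      obtain ⟨A, h2, h3⟩ := ((h1.eventually (gt_mem_nhds hε)).and (eventually_ge_atTop 0)).exists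
      refine ⟨A, h3, ?_⟩
      have : -(A * c / 4) / ℓ = -(A * (c / 4 / ℓ)) := by ring
      rwa [this]
    obtain ⟨s, hs, hs'⟩ := hlim A hA
    obtain ⟨k, hk, α, hα, hlt⟩ := hcase A hA
    have hGα : truncatedLog C K R A k α ≤ -(A * k) := by
      rw [truncatedLog, max_eq_right hlt.le, Real.log_exp]
    have hsle : s ≤ -(A * c / 4) := by
      refine le_of_tendsto hs ?_
      filter_upwards [hcM, eventually_ge_atTop (4 * k)] with n hn hkn
      exact sum_le_of_apply_le hC (truncatedLog_nonpos hR₁ hR hA) (truncatedLog_add_le hK hR₀)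
        hA hk hα hGα hkn hn
    have hslt : Real.exp (s / ℓ) * R < ε := by
      refine lt_of_le_of_lt ?_ hAε
      gcongr
    filter_upwards [hs'.eventually (gt_mem_nhds hslt), eventually_gt_atTop 0] with n hn hn0
    refine lt_of_le_of_lt ?_ hn
    rw [prod_chebyshevConst hR₀, ← exp_mul_pow_rpow hR₀ _ (L_pos hN hC hn0), exp_sum_truncatedLog]
    have h0 : ∀ α ∈ latticePoints C n, 0 ≤ chebyshevConst C K n α / R ^ ∑ i, α i := fun α _ =>
      div_nonneg (chebyshevConst_nonneg α) (by positivity)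
    refine Real.rpow_le_rpow (mul_nonneg (Finset.prod_nonneg h0) (by positivity)) ?_ (by positivity)
    gcongr with α hα
    · exact h0
    · exact le_max_left _ _

/-- The `limsup` defining the transfinite diameter is a limit. -/
theorem tendsto_diameter (hN : 1 ≤ N) (hC₀ : ∀ x ∈ C, ∀ i, 0 ≤ x i)
    (hC : unitSimplex N ⊆ (C : Set (Fin N → ℝ))) (hK : IsCompact K) (hne : K.Nonempty) :
    Tendsto (fun k : ℕ => diameter C (fun _ => 1) K k) atTop
      (𝓝 (transfiniteDiameter C (fun _ => 1) K)) := by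
  obtain ⟨d, hd⟩ := exists_tendsto_prod_chebyshevConst hN hC₀ hC hK
  have h1 := (tendsto_factorial_M_rpow hN hC₀ hC).mul hd
  rw [one_mul] at h1
  have hlim : Tendsto (fun k : ℕ => diameter C (fun _ => 1) K k) atTop (𝓝 d) := by
    refine tendsto_of_tendsto_of_tendsto_of_le_of_le hd h1 (fun k => ?_) fun k => ?_
    · exact Real.rpow_le_rpow (Finset.prod_nonneg fun α _ => chebyshevConst_nonneg α)
        (maxVdm_bounds hK hne k).1 (by positivity)
    · have h2 := maxVdm_bounds (C := C) hK hne k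
      have h0 : 0 ≤ ∏ α ∈ latticePoints C k, chebyshevConst C K k α :=
        Finset.prod_nonneg fun α _ => chebyshevConst_nonneg α
      beta_reduce
      rw [← Real.mul_rpow (by positivity) h0]
      exact Real.rpow_le_rpow (h0.trans h2.1) h2.2 (by positivity)
  rwa [transfiniteDiameter, hlim.limsup_eq]

end Asymptotics

end CDegree

end

theorem theorem5p1 (N : ℕ) (hN : 1 ≤ N) (C : ConvexBody (Fin N → ℝ))
    (hC_nonneg : ∀ x ∈ C, ∀ i, 0 ≤ x i)
    (hC_simplex : CDegree.unitSimplex N ⊆ (C : Set (Fin N → ℝ)))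
    (hdagger : CDegree.Dagger C)
    (K : Set (Fin N → ℂ)) (hK : IsCompact K)
    (a : ℕ → Fin N →₀ ℕ) (ha : CDegree.IsEnumeration C a)
    (ζ : ℕ → Fin N → ℂ) (hζ : CDegree.IsLeja C (fun _ => 1) a K ζ) :
    Filter.Tendsto
      (fun k : ℕ => ‖CDegree.seqVdm C (fun _ => 1) a (fun i : Fin (CDegree.M C k) => ζ i)‖ ^
        (1 / (CDegree.L C k : ℝ)))
      Filter.atTop (nhds (CDegree.transfiniteDiameter C (fun _ => 1) K)) := by
  have h1 := CDegree.tendsto_diameter hN hC_nonneg hC_simplex hK ⟨_, hζ.mem 0⟩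
  have h2 := h1.div (CDegree.tendsto_factorial_M_rpow hN hC_nonneg hC_simplex) one_ne_zero
  rw [div_one] at h2
  refine tendsto_of_tendsto_of_tendsto_of_le_of_le h2 h1 (fun k => ?_) fun k => ?_
  · obtain ⟨h3, h4⟩ := hζ.bounds hC_simplex hK ha k
    have hfac : (0 : ℝ) < (CDegree.M C k).factorial := by
      exact_mod_cast Nat.factorial_pos _
    simp only [Pi.div_apply]
    rw [div_le_iff₀ (Real.rpow_pos_of_pos hfac _), mul_comm,
      ← Real.mul_rpow hfac.le (norm_nonneg _)]
    exact Real.rpow_le_rpow ((norm_nonneg _).trans h3) h4 (by positivity)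
  · exact Real.rpow_le_rpow (norm_nonneg _) (hζ.bounds hC_simplex hK ha k).1 (by positivity)
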